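/- Let $\mathfrak R=(\mathbb Z_2[U,Q,\theta],d)$ be the commutative dg algebra over $\mathbb Z_2=\mathbb Z/2$ with $\deg U=2$, $\deg Q=\deg\theta=1$, $dU=Q^3$, $dQ=d\theta=0$, and let $\mathfrak R_0=(\mathbb Z_2[Q,U,U^{-1}],d)$ with $dQ=0$, $dU^n=nQ^3U^{n-1}$ for $n\in\mathbb Z$, regarded as an $\mathfrak R$-algebra by $U\mapsto U$, $Q\mapsto Q$, $\theta\mapsto 0$. Differentials have degree $+1$. A dg $\mathfrak R$-module $N$ is of weak SWF-type if $N\otimes_{\mathfrak R}\mathfrak R_0$ is quasi-isomorphic, as an $\mathfrak R_0$-module, to a degree shift of $\mathfrak R_0$. For $N,P$ of weak SWF-type and $i\in\{0,1,2\}$, an $\mathfrak R$-module map $f\colon N\to P$ (commuting with the differentials and raising degree by $i$) is a local map of level $i$ if $f\otimes\mathrm{id}\colon N\otimes_{\mathfrak R}\mathfrak R_0\to P\otimes_{\mathfrak R}\mathfrak R_0$ is homotopic, through $\mathfrak R_0$-linear maps, to $Q^i\cdot f'$ for some degree-preserving $\mathfrak R_0$-module quasi-isomorphism $f'$. (All modules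 to which this is applied below are finitely generated and semifree, so the tensor products are also the derived ones.) Let $M$ be the dg $\mathfrak R$-module which is freely generated over $\mathfrak R$ by $x_i$ $(|i|\le 5)$ and $y_j$ $(0<|j|\le 5)$, graded so that $\deg x_0=0$ and $d$ has degree $1$, with differential \[ \begin{aligned} dx_0&=(U+\theta^2)y_1+(U+\theta^2+Q^2)y_{-1},\\ dx_1&=Uy_1+(U+\theta^2)y_2+Q^2(y_{-1}+y_{-2})+Q(x_1+x_{-1}),\\ dx_{-1}&=Uy_{-1}+(U+\theta^2)y_{-2}+Q(x_1+x_{-1}),\\ dx_2&=Uy_2+U^2y_3+Q^2y_{-2}+Q(x_2+x_{-2}),\\ dx_{-2}&=Uy_{-2}+U^2y_{-3}+Q(x_2+x_{-2}),\\ dx_3&=(U+\theta^2)y_3+U(U^2+\theta^4)y_4+Q^2y_{-3}+Q^2(U^2+\theta^4)y_{-4}+Q(x_3+x_{-3}),\\ dx_{-3}&=(U+\theta^2)y_{-3}+U(U^2+\theta^4)y_{-4}+Q(x_3+x_{-3}),\\ dx_4&=Uy_4+U^2(U^2+\theta^4)y_5+Q^2y_{-4}+Q(x_4+x_{-4}),\\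 dx_{-4}&=Uy_{-4}+U^2(U^2+\theta^4)y_{-5}+Q(x_4+x_{-4}),\\ dx_5&=(U+\theta^2)y_5+Q^2y_{-5}+Q(x_5+x_{-5}),\\ dx_{-5}&=(U+\theta^2)y_{-5}+Q(x_5+x_{-5}),\\ dy_j&=Q(y_j+y_{-j})\quad\text{for all }j. \end{aligned} \] (This is the explicit module associated with the Brieskorn sphere $\Sigma(3,5,19)$.) Then $M$, $M^{\otimes 2}$, $M^{\otimes 3}$ and $M^{\otimes 4}$ (tensor powers over $\mathfrak R$) are of weak SWF-type, and: 1. there is no local map of level $2$ from $\mathfrak R$ to $M\otimes_{\mathfrak R}M\otimes_{\mathfrak R}M$; 2. there is no local map of level $2$ from $\mathfrak R$ to $M\otimes_{\mathfrak R}M\otimes_{\mathfrak R}M\otimes_{\mathfrak R}M$; 3. there is a local map of level $2$ from $\mathfrak R$ to $M\otimes_{\mathfrak R}M$. -/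

import Mathlib

open scoped TensorProduct DirectSum

noncomputable section

namespace DG

/-! ### Differential graded algebras and modules in characteristic two

Over `ℤ/2` no Koszul signs occur. Gradings are cohomological: differentials raise degree by one. -/

/-- A commutative `ℤ`-graded dg algebra over `ℤ/2`. -/
class DGAlg (A : Type) [CommRing A] [Algebra (ZMod 2) A] where
  deg : ℤ → Submodule (ZMod 2) A
  [gradedAlgebra : GradedAlgebra deg]
  d : Derivation (ZMod 2) A A
  d_mem : ∀ {n : ℤ} {a : A}, a ∈ deg n → d a ∈ deg (n + 1)
  d_d : ∀ a : A, d (d a) = 0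

attribute [instance] DGAlg.gradedAlgebra

/-- A dg module over a commutative dg algebra `A` over `ℤ/2`. -/
class DGMod (A : Type) [CommRing A] [Algebra (ZMod 2) A] [DGAlg A]
    (M : Type) [AddCommGroup M] [Module A M] where
  deg : ℤ → AddSubgroup M
  isInternal : DirectSum.IsInternal deg
  smul_mem : ∀ {i j : ℤ} {a : A} {m : M}, a ∈ DGAlg.deg i → m ∈ deg j → a • m ∈ deg (i + j)
  d : M →+ M
  d_smul : ∀ (a : A) (m : M), d (a • m) = DGAlg.d a • m + a • d m
  d_mem : ∀ {n : ℤ} {m : M}, m ∈ deg n → d m ∈ deg (n + 1)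
  d_d : ∀ m : M, d (d m) = 0

/-- A criterion for an internal grading: a map `dec` to the direct sum which is a two-sided inverse
of the summation map. -/
theorem isInternal_of_dec {M : Type} [AddCommGroup M] (deg : ℤ → AddSubgroup M)
    (dec : M →+ ⨁ i, deg i)
    (h1 : ∀ m, DirectSum.coeAddMonoidHom deg (dec m) = m)
    (h2 : ∀ (i : ℤ) (m : M) (hm : m ∈ deg i), dec m = DirectSum.of (fun i => deg i) i ⟨m, hm⟩) :
    DirectSum.IsInternal deg := by
  refine ⟨Function.LeftInverse.injective (g := dec) ?_, Function.RightInverse.surjective h1⟩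
  have : dec.comp (DirectSum.coeAddMonoidHom deg) = AddMonoidHom.id _ := by
    refine DirectSum.addHom_ext fun i y => ?_
    simp only [AddMonoidHom.comp_apply, DirectSum.coeAddMonoidHom_of, AddMonoidHom.id_apply]
    exact h2 i _ y.2
  exact fun x => DFunLike.congr_fun this x

/-- Every element of an internally graded group is a sum of homogeneous elements. -/
theorem homogeneous_induction {M : Type} [AddCommGroup M] {deg : ℤ → AddSubgroup M}
    (h : DirectSum.IsInternal deg) {p : M → Prop} (h0 : p 0)
    (hh : ∀ i m, m ∈ deg i → p m) (hadd : ∀ m n, p m → p n → p (m + n)) (m : M) : p m := by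
  obtain ⟨x, rfl⟩ := h.2 m
  induction x using DirectSum.induction_on with
  | zero => simpa using h0
  | of i x => simpa using hh i _ x.2
  | add x y hx hy => simpa using hadd _ _ hx hy

section Algebra

variable (A : Type) [CommRing A] [Algebra (ZMod 2) A] [DGAlg A]

theorem DGAlg.isInternal :
    DirectSum.IsInternal (fun n : ℤ => (DGAlg.deg n : Submodule (ZMod 2) A).toAddSubgroup) :=
  DirectSum.Decomposition.isInternal (DGAlg.deg (A := A))

/-- A dg algebra as a dg module over itself. -/
instance selfDGMod : DGMod A A where
  deg n := (DGAlg.deg n : Submodule (ZMod 2) A).toAddSubgroup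
  isInternal := DGAlg.isInternal A
  smul_mem ha hm := SetLike.mul_mem_graded (A := DGAlg.deg (A := A)) ha hm
  d := (DGAlg.d (A := A)).toLinearMap.toAddMonoidHom
  d_smul a m := by
    have := (DGAlg.d (A := A)).leibniz a m
    simp only [smul_eq_mul] at this ⊢
    change DGAlg.d (a * m) = DGAlg.d a * m + a * DGAlg.d m
    rw [this]; ring
  d_mem h := DGAlg.d_mem h
  d_d a := DGAlg.d_d a

end Algebra

/-! ### Tensor products -/

section Tensor

variable {A : Type} [CommRing A] [Algebra (ZMod 2) A] [DGAlg A]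
variable (M N : Type) [AddCommGroup M] [Module A M] [AddCommGroup N] [Module A N]
variable [DGMod A M] [DGMod A N]

/-- Degree `n` part of `M ⊗ N`: sums of `x ⊗ y` with `deg x + deg y = n`. -/
def tensorDeg (n : ℤ) : AddSubgroup (M ⊗[A] N) :=
  AddSubgroup.closure {z | ∃ (i j : ℤ) (x : M) (y : N), i + j = n ∧
    x ∈ DGMod.deg A i ∧ y ∈ DGMod.deg A j ∧ z = x ⊗ₜ[A] y}

/-- The differential `d (x ⊗ y) = d x ⊗ y + x ⊗ d y`. -/
def tensorD : M ⊗[A] N →+ M ⊗[A] N :=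
  TensorProduct.liftAddHom
    (AddMonoidHom.mk' (fun x => AddMonoidHom.mk'
      (fun y => DGMod.d A x ⊗ₜ[A] y + x ⊗ₜ[A] DGMod.d A y)
      (fun y z => by simp only [map_add, TensorProduct.tmul_add]; abel))
      (fun x z => by
        ext y
        simp only [AddMonoidHom.mk'_apply, AddMonoidHom.add_apply, map_add,
          TensorProduct.add_tmul]
        abel))
    (fun a x y => by
      simp only [AddMonoidHom.mk'_apply, DGMod.d_smul, TensorProduct.add_tmul,
        TensorProduct.tmul_add, TensorProduct.smul_tmul]
      abel)

variable {M N}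

@[simp] theorem tensorD_tmul (x : M) (y : N) :
    tensorD (A := A) M N (x ⊗ₜ[A] y) = DGMod.d A x ⊗ₜ[A] y + x ⊗ₜ[A] DGMod.d A y := rfl

theorem tmul_mem_tensorDeg {i j n : ℤ} {x : M} {y : N} (h : i + j = n)
    (hx : x ∈ DGMod.deg A i) (hy : y ∈ DGMod.deg A j) :
    x ⊗ₜ[A] y ∈ tensorDeg (A := A) M N n :=
  AddSubgroup.subset_closure ⟨i, j, x, y, h, hx, hy, rfl⟩

theorem tensor_isInternal : DirectSum.IsInternal (tensorDeg (A := A) M N) := by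
  let _ : DirectSum.Decomposition (DGMod.deg A (M := M)) :=
    DirectSum.IsInternal.chooseDecomposition _ DGMod.isInternal
  let _ : DirectSum.Decomposition (DGMod.deg A (M := N)) :=
    DirectSum.IsInternal.chooseDecomposition _ DGMod.isInternal
  let β : ∀ i j : ℤ, (DGMod.deg A (M := M) i) →+ (DGMod.deg A (M := N) j) →+
      ⨁ n, tensorDeg (A := A) M N n := fun i j =>
    AddMonoidHom.mk' (fun x => AddMonoidHom.mk'
      (fun y => DirectSum.of (fun n => tensorDeg (A := A) M N n) (i + j)
        ⟨(x : M) ⊗ₜ[A] (y : N), tmul_mem_tensorDeg rfl x.2 y.2⟩)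
      (fun y z => by
        rw [← map_add]; congr 1; ext; simp [TensorProduct.tmul_add]))
      (fun x z => by
        ext1 y
        simp only [AddMonoidHom.mk'_apply, AddMonoidHom.add_apply]
        rw [← map_add]; congr 1; ext; simp [TensorProduct.add_tmul])
  let γ : (⨁ i, DGMod.deg A (M := M) i) →+ (⨁ j, DGMod.deg A (M := N) j) →+
      ⨁ n, tensorDeg (A := A) M N n :=
    DirectSum.toAddMonoid fun i => AddMonoidHom.flip
      (DirectSum.toAddMonoid fun j => AddMonoidHom.flip (β i j))
  let δ : M →+ N →+ ⨁ n, tensorDeg (A := A) M N n :=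
    (AddMonoidHom.compHom.flip
      (DirectSum.decomposeAddEquiv (DGMod.deg A (M := N))).toAddMonoidHom).comp
      (γ.comp (DirectSum.decomposeAddEquiv (DGMod.deg A (M := M))).toAddMonoidHom)
  have hδ : ∀ (i j n : ℤ) (x : M) (y : N) (hx : x ∈ DGMod.deg A i) (hy : y ∈ DGMod.deg A j)
      (h : i + j = n), δ x y = DirectSum.of (fun n => tensorDeg (A := A) M N n) n
        ⟨x ⊗ₜ[A] y, tmul_mem_tensorDeg h hx hy⟩ := by
    intro i j n x y hx hy h
    subst h
    change γ (DirectSum.decompose _ x) (DirectSum.decompose _ y) = _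
    rw [DirectSum.decompose_of_mem _ hx, DirectSum.decompose_of_mem _ hy]
    simp only [γ, DirectSum.toAddMonoid_of, AddMonoidHom.flip_apply]
    rfl
  have hbal : ∀ (a : A) (x : M) (y : N), δ (a • x) y = δ x (a • y) := by
    intro a x y
    refine homogeneous_induction (DGAlg.isInternal A)
      (p := fun a => δ (a • x) y = δ x (a • y)) (by simp) ?_ ?_ a
    swap
    · intro a b ha hb; simp [add_smul, ha, hb]
    intro k a ha
    refine homogeneous_induction (DGMod.isInternal (A := A) (M := M))
      (p := fun x => δ (a • x) y = δ x (a • y)) (by simp) ?_ ?_ x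
    swap
    · intro x x' hx hx'; simp [hx, hx']
    intro i x hx
    refine homogeneous_induction (DGMod.isInternal (A := A) (M := N))
      (p := fun y => δ (a • x) y = δ x (a • y)) (by simp) ?_ ?_ y
    swap
    · intro y y' hy hy'; simp [hy, hy']
    intro j y hy
    rw [hδ (k + i) j (i + (k + j)) _ _ (DGMod.smul_mem ha hx) hy (by ring),
      hδ i (k + j) (i + (k + j)) _ _ hx (DGMod.smul_mem ha hy) rfl]
    congr 2
    exact TensorProduct.smul_tmul _ _ _
  refine isInternal_of_dec _ (TensorProduct.liftAddHom δ hbal) ?_ ?_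
  · intro z
    induction z using TensorProduct.induction_on with
    | zero => simp
    | add z w hz hw => rw [map_add, map_add, hz, hw]
    | tmul x y =>
      rw [TensorProduct.liftAddHom_tmul]
      refine homogeneous_induction (DGMod.isInternal (A := A) (M := M))
        (p := fun x => DirectSum.coeAddMonoidHom _ (δ x y) = x ⊗ₜ[A] y) (by simp) ?_ ?_ x
      swap
      · intro x x' hx hx'; simp [hx, hx', TensorProduct.add_tmul]
      intro i x hx
      refine homogeneous_induction (DGMod.isInternal (A := A) (M := N))
        (p := fun y => DirectSum.coeAddMonoidHom _ (δ x y) = x ⊗ₜ[A] y) (by simp) ?_ ?_ y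
      swap
      · intro y y' hy hy'; simp [hy, hy', TensorProduct.tmul_add]
      intro j y hy
      rw [hδ i j _ x y hx hy rfl, DirectSum.coeAddMonoidHom_of]
  · intro n z hz
    induction hz using AddSubgroup.closure_induction with
    | mem z hz' =>
      obtain ⟨i, j, x, y, h, hx, hy, rfl⟩ := hz'
      rw [TensorProduct.liftAddHom_tmul, hδ i j n x y hx hy h]
    | zero =>
      rw [map_zero]
      exact (map_zero (DirectSum.of (fun n => tensorDeg (A := A) M N n) n)).symm
    | add z w hz hw ihz ihw => rw [map_add, ihz, ihw, ← map_add]; rfl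
    | neg z hz ihz => rw [map_neg, ihz, ← map_neg]; rfl

/-- In a dg module over a `ℤ/2`-algebra, every element is its own negative. -/
theorem add_self_eq_zero' (A : Type) [CommRing A] [Algebra (ZMod 2) A]
    {P : Type} [AddCommGroup P] [Module A P] (z : P) : z + z = 0 := by
  have h : (1 : A) + 1 = 0 := by
    have := congrArg (algebraMap (ZMod 2) A) (show (1 : ZMod 2) + 1 = 0 by decide)
    simpa using this
  have := congrArg (fun a : A => a • z) h
  simpa [add_smul] using this

theorem tensorD_smul (a : A) (z : M ⊗[A] N) :
    tensorD (A := A) M N (a • z) = DGAlg.d a • z + a • tensorD (A := A) M N z := by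
  induction z using TensorProduct.induction_on with
  | zero => simp
  | add z w hz hw => rw [smul_add, map_add, hz, hw, map_add, smul_add, smul_add]; abel
  | tmul x y =>
    rw [TensorProduct.smul_tmul', tensorD_tmul, tensorD_tmul, DGMod.d_smul,
      TensorProduct.add_tmul, smul_add, TensorProduct.smul_tmul', TensorProduct.smul_tmul',
      TensorProduct.smul_tmul']
    abel

theorem tensorD_mem {n : ℤ} {z : M ⊗[A] N} (hz : z ∈ tensorDeg (A := A) M N n) :
    tensorD (A := A) M N z ∈ tensorDeg (A := A) M N (n + 1) := by
  induction hz using AddSubgroup.closure_induction with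
  | mem z hz' =>
    obtain ⟨i, j, x, y, h, hx, hy, rfl⟩ := hz'
    exact add_mem (tmul_mem_tensorDeg (by omega) (DGMod.d_mem hx) hy)
      (tmul_mem_tensorDeg (by omega) hx (DGMod.d_mem hy))
  | zero => simp
  | add z w hz hw ihz ihw => rw [map_add]; exact add_mem ihz ihw
  | neg z hz ihz => rw [map_neg]; exact neg_mem ihz

theorem tensorD_tensorD (z : M ⊗[A] N) :
    tensorD (A := A) M N (tensorD (A := A) M N z) = 0 := by
  induction z using TensorProduct.induction_on with
  | zero => simp
  | add z w hz hw => rw [map_add, map_add, hz, hw, add_zero]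
  | tmul x y =>
    simp only [tensorD_tmul, map_add, DGMod.d_d, TensorProduct.zero_tmul, TensorProduct.tmul_zero,
      zero_add, add_zero]
    exact add_self_eq_zero' A _

/-- The tensor product over `A` of two dg modules. -/
instance tensorDGMod : DGMod A (M ⊗[A] N) where
  deg := tensorDeg (A := A) M N
  isInternal := tensor_isInternal
  smul_mem := by
    intro i j a z ha hz
    induction hz using AddSubgroup.closure_induction with
    | mem z hz' =>
      obtain ⟨k, l, x, y, h, hx, hy, rfl⟩ := hz'
      rw [TensorProduct.smul_tmul']
      exact tmul_mem_tensorDeg (by omega) (DGMod.smul_mem ha hx) hy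
    | zero => simp
    | add z w hz hw ihz ihw => rw [smul_add]; exact add_mem ihz ihw
    | neg z hz ihz => rw [smul_neg]; exact neg_mem ihz
  d := tensorD (A := A) M N
  d_smul := tensorD_smul
  d_mem := tensorD_mem
  d_d := tensorD_tensorD

end Tensor

/-! ### Extension of scalars -/

section BaseChange

/-- The structure map `A → B` is a morphism of dg algebras. -/
class DGExt (A B : Type) [CommRing A] [Algebra (ZMod 2) A] [DGAlg A]
    [CommRing B] [Algebra (ZMod 2) B] [DGAlg B] [Algebra A B] : Prop where
  map_mem : ∀ {n : ℤ} {a : A}, a ∈ DGAlg.deg n → algebraMap A B a ∈ DGAlg.deg n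
  map_d : ∀ a : A, algebraMap A B (DGAlg.d a) = DGAlg.d (algebraMap A B a)

variable (A B : Type) [CommRing A] [Algebra (ZMod 2) A] [DGAlg A]
  [CommRing B] [Algebra (ZMod 2) B] [DGAlg B] [Algebra A B] [DGExt A B]

/-- `B` as a dg module over `A`. -/
@[reducible] def restrictDGMod : DGMod A B where
  deg n := (DGAlg.deg n : Submodule (ZMod 2) B).toAddSubgroup
  isInternal := DGAlg.isInternal B
  smul_mem ha hm := by
    rw [Algebra.smul_def]
    exact SetLike.mul_mem_graded (A := DGAlg.deg (A := B)) (DGExt.map_mem ha) hm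
  d := (DGAlg.d (A := B)).toLinearMap.toAddMonoidHom
  d_smul a m := by
    change DGAlg.d (a • m) = _ + a • DGAlg.d m
    rw [Algebra.smul_def, Algebra.smul_def, Algebra.smul_def, DGExt.map_d, Derivation.leibniz]
    simp only [smul_eq_mul]; ring
  d_mem h := DGAlg.d_mem h
  d_d a := DGAlg.d_d a

variable (M : Type) [AddCommGroup M] [Module A M] [DGMod A M]

/-- The extension of scalars `B ⊗ M` along `A → B`, a dg module over `B`. -/
instance baseChangeDGMod : DGMod B (B ⊗[A] M) :=
  letI := restrictDGMod A B
  { deg := DGMod.deg A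
    isInternal := DGMod.isInternal
    smul_mem := by
      intro i j b z hb hz
      induction hz using AddSubgroup.closure_induction with
      | mem z hz' =>
        obtain ⟨k, l, x, y, h, hx, hy, rfl⟩ := hz'
        rw [TensorProduct.smul_tmul']
        exact tmul_mem_tensorDeg (i := i + k) (by omega)
          (SetLike.mul_mem_graded (A := DGAlg.deg (A := B)) hb hx) hy
      | zero => simp
      | add z w hz hw ihz ihw => rw [smul_add]; exact add_mem ihz ihw
      | neg z hz ihz => rw [smul_neg]; exact neg_mem ihz
    d := DGMod.d A
    d_smul := by
      intro b z
      induction z using TensorProduct.induction_on with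
      | zero => simp
      | add z w hz hw => rw [smul_add, map_add, hz, hw, map_add, smul_add, smul_add]; abel
      | tmul x y =>
        change tensorD (A := A) B M _ = _ + b • tensorD (A := A) B M _
        have e : DGMod.d A (b * x) = DGAlg.d b * x + b * DGMod.d A x :=
          DGMod.d_smul (A := B) b x
        rw [TensorProduct.smul_tmul', tensorD_tmul, tensorD_tmul, smul_eq_mul, e,
          TensorProduct.add_tmul, smul_add, TensorProduct.smul_tmul', TensorProduct.smul_tmul',
          TensorProduct.smul_tmul']
        simp only [smul_eq_mul]
        abel
    d_mem := DGMod.d_mem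
    d_d := DGMod.d_d }

variable {A B M} in
theorem baseChange_d_tmul (b : B) (m : M) :
    DGMod.d B (b ⊗ₜ[A] m) = DGAlg.d b ⊗ₜ[A] m + b ⊗ₜ[A] DGMod.d A m := rfl

end BaseChange

/-! ### Maps of dg modules -/

section Maps

variable {A : Type} [CommRing A] [Algebra (ZMod 2) A] [DGAlg A]
variable {M N : Type} [AddCommGroup M] [Module A M] [AddCommGroup N] [Module A N]
variable [DGMod A M] [DGMod A N]

/-- `f` raises degree by `k`. -/
def HasDegree (f : M →ₗ[A] N) (k : ℤ) : Prop :=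
  ∀ n : ℤ, ∀ m ∈ DGMod.deg A n, f m ∈ DGMod.deg A (n + k)

/-- `f` commutes with the differentials. -/
def IsChainMap (f : M →ₗ[A] N) : Prop :=
  ∀ m : M, f (DGMod.d A m) = DGMod.d A (f m)

/-- A dg module map of degree `k`: an `A`-linear chain map which raises degree by `k`. -/
def IsDGMap (f : M →ₗ[A] N) (k : ℤ) : Prop :=
  HasDegree f k ∧ IsChainMap f

/-- A quasi-isomorphism of degree `k`: a dg module map of degree `k` which induces an injective
and surjective map from the cohomology of `M` to the cohomology of `N`. -/
def IsQuasiIso (f : M →ₗ[A] N) (k : ℤ) : Prop :=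
  IsDGMap f k ∧
  (∀ m : M, DGMod.d A m = 0 → (∃ b : N, f m = DGMod.d A b) → ∃ c : M, m = DGMod.d A c) ∧
  (∀ y : N, DGMod.d A y = 0 → ∃ m : M, DGMod.d A m = 0 ∧ ∃ b : N, y = f m + DGMod.d A b)

/-- Two `A`-linear maps of degree `k` are homotopic: they differ by `d h + h d` for an
`A`-linear map `h` of degree `k - 1`. -/
def AreHomotopic (f g : M →ₗ[A] N) (k : ℤ) : Prop :=
  ∃ h : M →ₗ[A] N, HasDegree h (k - 1) ∧
    ∀ m : M, f m - g m = DGMod.d A (h m) + h (DGMod.d A m)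

end Maps

/-! ### The dg algebras -/

/-- The ring `ℤ/2[U, Q, θ]`. -/
abbrev R : Type := MvPolynomial (Fin 3) (ZMod 2)

namespace R

def U : R := MvPolynomial.X 0
def Q : R := MvPolynomial.X 1
def θ : R := MvPolynomial.X 2

/-- `deg U = 2`, `deg Q = deg θ = 1`. -/
def weight : Fin 3 → ℤ := ![2, 1, 1]

/-- The derivation with `d U = Q ^ 3`, `d Q = 0`, `d θ = 0`. -/
def d : Derivation (ZMod 2) R R := MvPolynomial.mkDerivation (ZMod 2) ![Q ^ 3, 0, 0]

@[simp] theorem d_U : d U = Q ^ 3 := by simp [d, U]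
@[simp] theorem d_Q : d Q = 0 := by simp [d, Q]
@[simp] theorem d_θ : d θ = 0 := by simp [d, θ]

end R

namespace R

theorem d_eq (p : R) : d p = MvPolynomial.pderiv 0 p * Q ^ 3 := by
  have h : d = (Q ^ 3) • MvPolynomial.pderiv (R := ZMod 2) (0 : Fin 3) := by
    refine MvPolynomial.derivation_ext fun i => ?_
    fin_cases i <;> simp [d]
  rw [h, Derivation.smul_apply, smul_eq_mul, mul_comm]

theorem pderiv_pderiv (p : R) :
    MvPolynomial.pderiv 0 (MvPolynomial.pderiv (0 : Fin 3) p) = 0 := by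
  induction p using MvPolynomial.induction_on' with
  | add p q hp hq => rw [map_add, map_add, hp, hq, add_zero]
  | monomial u a =>
    rw [MvPolynomial.pderiv_monomial, MvPolynomial.pderiv_monomial]
    have : ((u 0 : ℕ) : ZMod 2) * (((u 0 - 1 : ℕ)) : ZMod 2) = 0 := by
      rw [← Nat.cast_mul, ZMod.natCast_eq_zero_iff]
      have := Nat.even_mul_pred_self (u 0)
      exact this.two_dvd
    simp [mul_assoc, this]

theorem Q_weight : MvPolynomial.IsWeightedHomogeneous weight Q 1 :=
  MvPolynomial.isWeightedHomogeneous_X _ _ 1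

theorem U_weight : MvPolynomial.IsWeightedHomogeneous weight U 2 :=
  MvPolynomial.isWeightedHomogeneous_X _ _ 0

theorem θ_weight : MvPolynomial.IsWeightedHomogeneous weight θ 1 :=
  MvPolynomial.isWeightedHomogeneous_X _ _ 2

end R

/-- The dg algebra `R = (ℤ/2[U, Q, θ], d U = Q ^ 3)`. -/
instance : DGAlg R where
  deg n := MvPolynomial.weightedHomogeneousSubmodule (ZMod 2) R.weight n
  gradedAlgebra := MvPolynomial.weightedGradedAlgebra (ZMod 2) R.weight
  d := R.d
  d_mem := by
    intro n p hp
    rw [R.d_eq]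
    have h1 : (MvPolynomial.pderiv 0 p).IsWeightedHomogeneous R.weight (n - 2) :=
      MvPolynomial.IsWeightedHomogeneous.pderiv hp (by simp [R.weight])
    have h2 := h1.mul (R.Q_weight.pow 3)
    have e : n - 2 + 3 • (1 : ℤ) = n + 1 := by simp; ring
    rw [e] at h2
    exact h2
  d_d p := by
    rw [R.d_eq, R.d_eq, Derivation.leibniz, R.pderiv_pderiv]
    simp [R.Q, MvPolynomial.pderiv_X]

/-- The ring `ℤ/2[Q, U, U⁻¹]`; the basis element with exponent `(i, j)` is `Q ^ i * U ^ j`. -/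
abbrev R₀ : Type := AddMonoidAlgebra (ZMod 2) (ℕ × ℤ)

namespace R₀

/-- The monomial `Q ^ i * U ^ j`. -/
def mono (i : ℕ) (j : ℤ) : R₀ := AddMonoidAlgebra.single (i, j) 1

def Q : R₀ := mono 1 0
def U : R₀ := mono 0 1

/-- `deg (Q ^ i * U ^ j) = i + 2 * j`. -/
def weight : ℕ × ℤ →+ ℤ where
  toFun p := p.1 + 2 * p.2
  map_zero' := by simp
  map_add' p q := by simp; ring

/-- The `ℤ/2`-linear map with `d (Q ^ i * U ^ j) = j * Q ^ (i + 3) * U ^ (j - 1)`. -/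
def dLin : R₀ →ₗ[ZMod 2] R₀ :=
  (AddMonoidAlgebra.basis (ℕ × ℤ) (ZMod 2)).constr (ZMod 2)
    fun p => ((p.2 : ℤ) : ZMod 2) • mono (p.1 + 3) (p.2 - 1)

theorem dLin_mono (i : ℕ) (j : ℤ) :
    dLin (mono i j) = ((j : ℤ) : ZMod 2) • mono (i + 3) (j - 1) := by
  have := (AddMonoidAlgebra.basis (ℕ × ℤ) (ZMod 2)).constr_basis (ZMod 2)
    (fun p : ℕ × ℤ => ((p.2 : ℤ) : ZMod 2) • mono (p.1 + 3) (p.2 - 1)) (i, j)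
  rw [AddMonoidAlgebra.basis_apply] at this
  exact this

theorem mono_mul (i k : ℕ) (j l : ℤ) : mono i j * mono k l = mono (i + k) (j + l) := by
  simp [mono, AddMonoidAlgebra.single_mul_single]

theorem mono_zero : mono 0 0 = 1 := rfl

theorem induction {p : R₀ → Prop} (h0 : p 0) (hm : ∀ i j, p (mono i j))
    (hadd : ∀ a b, p a → p b → p (a + b)) (a : R₀) : p a := by
  induction a using AddMonoidAlgebra.induction_linear with
  | zero => exact h0
  | add a b ha hb => exact hadd a b ha hb
  | single m r =>
    obtain rfl | rfl : r = 0 ∨ r = 1 := by revert r; decide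
    · simpa using h0
    · exact hm m.1 m.2

theorem dLin_mul (a b : R₀) : dLin (a * b) = a • dLin b + b • dLin a := by
  induction a using induction with
  | h0 => simp
  | hadd a a' ha ha' =>
    rw [add_mul, map_add, ha, ha', map_add, add_smul, smul_add]; abel
  | hm i j =>
    induction b using induction with
    | h0 => simp
    | hadd b b' hb hb' =>
      rw [mul_add, map_add, hb, hb', map_add, add_smul, smul_add]; abel
    | hm k l =>
      rw [mono_mul, dLin_mono, dLin_mono, dLin_mono, smul_eq_mul, smul_eq_mul, mul_smul_comm,
        mul_smul_comm, mono_mul, mono_mul]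
      rw [show i + (k + 3) = i + k + 3 by ring, show j + (l - 1) = j + l - 1 by ring,
        show k + (i + 3) = i + k + 3 by ring, show l + (j - 1) = j + l - 1 by ring, ← add_smul]
      congr 1
      push_cast
      ring

def d : Derivation (ZMod 2) R₀ R₀ := Derivation.mk' dLin dLin_mul

theorem d_mono (i : ℕ) (j : ℤ) :
    d (mono i j) = ((j : ℤ) : ZMod 2) • mono (i + 3) (j - 1) := dLin_mono i j

@[simp] theorem d_Q : d Q = 0 := by simp [Q, d_mono]
@[simp] theorem d_U : d U = Q ^ 3 := by
  simp [Q, U, d_mono, pow_succ, mono_mul]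

theorem mono_mem (i : ℕ) (j : ℤ) :
    mono i j ∈ AddMonoidAlgebra.gradeBy (ZMod 2) weight (i + 2 * j) :=
  AddMonoidAlgebra.single_mem_gradeBy weight (i, j) 1

theorem Q_mem : Q ∈ AddMonoidAlgebra.gradeBy (ZMod 2) weight 1 := by
  have h := mono_mem 1 0
  simp only [Nat.cast_one, mul_zero, add_zero] at h
  exact h

theorem U_mem : U ∈ AddMonoidAlgebra.gradeBy (ZMod 2) weight 2 := by
  have h := mono_mem 0 1
  simp only [Nat.cast_zero, mul_one, zero_add] at h
  exact h

end R₀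

/-- The dg algebra `R₀ = (ℤ/2[Q, U, U⁻¹], d Uⁿ = n Q ^ 3 Uⁿ⁻¹)`. -/
instance : DGAlg R₀ where
  deg n := AddMonoidAlgebra.gradeBy (ZMod 2) R₀.weight n
  gradedAlgebra := AddMonoidAlgebra.gradeBy.gradedAlgebra R₀.weight
  d := R₀.d
  d_mem := by
    intro n a ha
    have hs := a.sum_coeff_single
    rw [← hs, Finsupp.sum, map_sum]
    refine Submodule.sum_mem _ fun m hm => ?_
    have hw : R₀.weight m = n := ha m hm
    have e : (AddMonoidAlgebra.single m (a.coeff m) : R₀) = a.coeff m • R₀.mono m.1 m.2 := by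
      simp [R₀.mono]
    rw [e, Derivation.map_smul, R₀.d_mono]
    refine Submodule.smul_mem _ _ (Submodule.smul_mem _ _ ?_)
    have h := R₀.mono_mem (m.1 + 3) (m.2 - 1)
    have e' : (((m.1 + 3 : ℕ) : ℤ) + 2 * (m.2 - 1)) = n + 1 := by
      rw [← hw]; simp [R₀.weight]; ring
    rw [e'] at h
    exact h
  d_d a := by
    induction a using R₀.induction with
    | h0 => simp
    | hadd a b ha hb => rw [map_add, map_add, ha, hb, add_zero]
    | hm i j =>
      rw [R₀.d_mono, Derivation.map_smul, R₀.d_mono, smul_smul]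
      have : ((j : ℤ) : ZMod 2) * ((j - 1 : ℤ) : ZMod 2) = 0 := by
        rw [← Int.cast_mul, ZMod.intCast_zmod_eq_zero_iff_dvd]
        exact (Int.even_mul_pred_self j).two_dvd
      rw [this, zero_smul]

/-- `R₀` is an algebra over `R` through `U ↦ U`, `Q ↦ Q`, `θ ↦ 0`. -/
instance : Algebra R R₀ :=
  (MvPolynomial.aeval (R := ZMod 2) ![R₀.U, R₀.Q, 0]).toRingHom.toAlgebra

theorem algebraMap_R (p : R) :
    algebraMap R R₀ p = MvPolynomial.aeval (R := ZMod 2) ![R₀.U, R₀.Q, 0] p := rfl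

instance : DGExt R R₀ where
  map_mem := by
    intro n p hp
    rw [algebraMap_R, MvPolynomial.as_sum p, map_sum]
    refine Submodule.sum_mem _ fun m hm => ?_
    have hw : Finsupp.weight R.weight m = n := hp (MvPolynomial.mem_support_iff.1 hm)
    rw [MvPolynomial.aeval_monomial, ← Algebra.smul_def]
    refine Submodule.smul_mem _ _ ?_
    rw [Finsupp.prod_fintype _ _ (by simp), Fin.prod_univ_three]
    rw [Finsupp.weight_apply, Finsupp.sum_fintype _ _ (by simp), Fin.sum_univ_three] at hw
    subst hw
    refine SetLike.mul_mem_graded (SetLike.mul_mem_graded ?_ ?_) ?_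
    · exact SetLike.pow_mem_graded _ R₀.U_mem
    · exact SetLike.pow_mem_graded _ R₀.Q_mem
    · exact SetLike.pow_mem_graded (i := (1 : ℤ)) _ (zero_mem _)
  map_d := by
    intro p
    change algebraMap R R₀ (R.d p) = R₀.d (algebraMap R R₀ p)
    simp only [algebraMap_R]
    induction p using MvPolynomial.induction_on with
    | C a =>
      rw [← MvPolynomial.algebraMap_eq, Derivation.map_algebraMap, map_zero, AlgHom.commutes,
        Derivation.map_algebraMap]
    | add p q hp hq => simp only [map_add, hp, hq]
    | mul_X p i hp =>
      rw [Derivation.leibniz, map_add, map_mul, Derivation.leibniz, smul_eq_mul, smul_eq_mul,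
        map_mul, map_mul, hp]
      simp only [smul_eq_mul]
      congr 2
      fin_cases i <;> simp [R.d, R.Q]

/-! ### The module -/

/-- The basis elements: `xpi`, `xmi`, `ypj`, `ymj` stand for `x_i`, `x_{-i}`, `y_j`, `y_{-j}`. -/
inductive Gen : Type
  | x0
  | xp1 | xp2 | xp3 | xp4 | xp5
  | xm1 | xm2 | xm3 | xm4 | xm5
  | yp1 | yp2 | yp3 | yp4 | yp5
  | ym1 | ym2 | ym3 | ym4 | ym5
  deriving DecidableEq

open Gen in
instance : Fintype Gen where
  elems := {x0, xp1, xp2, xp3, xp4, xp5, xm1, xm2, xm3, xm4, xm5,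
    yp1, yp2, yp3, yp4, yp5, ym1, ym2, ym3, ym4, ym5}
  complete g := by cases g <;> decide

/-- The degrees of the basis elements. They are determined by `deg x_0 = 0` and the requirement
that the differential below has degree one. -/
def Gen.deg : Gen → ℤ
  | x0 => 0
  | xp1 | xm1 => 0
  | xp2 | xm2 => 0
  | xp3 | xm3 => -2
  | xp4 | xm4 => -6
  | xp5 | xm5 => -12
  | yp1 | ym1 => -1
  | yp2 | ym2 => -1
  | yp3 | ym3 => -3
  | yp4 | ym4 => -7
  | yp5 | ym5 => -13

/-- The free `R`-module on the basis `Gen`. -/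
def M : Type := Gen → R

instance : AddCommGroup M := Pi.addCommGroup
instance : Module R M := Pi.module _ _ _

namespace M

@[simp] theorem add_apply (v w : M) (g : Gen) : (v + w) g = v g + w g := rfl
@[simp] theorem zero_apply (g : Gen) : (0 : M) g = 0 := rfl
@[simp] theorem neg_apply (v : M) (g : Gen) : (-v) g = -v g := rfl
@[simp] theorem smul_apply (a : R) (v : M) (g : Gen) : (a • v) g = a * v g := rfl

/-- The coefficient of a basis element, as an additive map. -/
def coef (g : Gen) : M →+ R where
  toFun v := v g
  map_zero' := rfl
  map_add' _ _ := rfl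

@[simp] theorem coef_apply (g : Gen) (v : M) : coef g v = v g := rfl

/-- The basis elements of `M`. -/
def e (g : Gen) : M := (Pi.single g 1 : Gen → R)

open Gen R in
/-- The differential on the basis elements. -/
def dGen : Gen → M
  | x0 => (U + θ ^ 2) • e yp1 + (U + θ ^ 2 + Q ^ 2) • e ym1
  | xp1 => U • e yp1 + (U + θ ^ 2) • e yp2 + Q ^ 2 • (e ym1 + e ym2) + Q • (e xp1 + e xm1)
  | xm1 => U • e ym1 + (U + θ ^ 2) • e ym2 + Q • (e xp1 + e xm1)
  | xp2 => U • e yp2 + U ^ 2 • e yp3 + Q ^ 2 • e ym2 + Q • (e xp2 + e xm2)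
  | xm2 => U • e ym2 + U ^ 2 • e ym3 + Q • (e xp2 + e xm2)
  | xp3 => (U + θ ^ 2) • e yp3 + (U * (U ^ 2 + θ ^ 4)) • e yp4 + Q ^ 2 • e ym3
      + (Q ^ 2 * (U ^ 2 + θ ^ 4)) • e ym4 + Q • (e xp3 + e xm3)
  | xm3 => (U + θ ^ 2) • e ym3 + (U * (U ^ 2 + θ ^ 4)) • e ym4 + Q • (e xp3 + e xm3)
  | xp4 => U • e yp4 + (U ^ 2 * (U ^ 2 + θ ^ 4)) • e yp5 + Q ^ 2 • e ym4 + Q • (e xp4 + e xm4)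
  | xm4 => U • e ym4 + (U ^ 2 * (U ^ 2 + θ ^ 4)) • e ym5 + Q • (e xp4 + e xm4)
  | xp5 => (U + θ ^ 2) • e yp5 + Q ^ 2 • e ym5 + Q • (e xp5 + e xm5)
  | xm5 => (U + θ ^ 2) • e ym5 + Q • (e xp5 + e xm5)
  | yp1 | ym1 => Q • (e yp1 + e ym1)
  | yp2 | ym2 => Q • (e yp2 + e ym2)
  | yp3 | ym3 => Q • (e yp3 + e ym3)
  | yp4 | ym4 => Q • (e yp4 + e ym4)
  | yp5 | ym5 => Q • (e yp5 + e ym5)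

/-- Degree `n` part of `M`: the coefficient of the basis element `g` has degree `n - deg g`. -/
def deg (n : ℤ) : AddSubgroup M where
  carrier := {v | ∀ g, v g ∈ DGAlg.deg (A := R) (n - g.deg)}
  zero_mem' _ := zero_mem _
  add_mem' hv hw g := add_mem (hv g) (hw g)
  neg_mem' hv g := neg_mem (hv g)

/-- The differential `d (∑ a_g • g) = ∑ (d a_g • g + a_g • d g)`. -/
def d : M →+ M where
  toFun v := ∑ g, (R.d (v g) • e g + v g • dGen g)
  map_zero' := by
    simp
  map_add' v w := by
    rw [← Finset.sum_add_distrib]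
    refine Finset.sum_congr rfl fun g _ => ?_
    rw [add_apply, map_add, add_smul, add_smul]; abel

theorem e_apply (g h : Gen) : e g h = if h = g then 1 else 0 := by
  exact Pi.single_apply g (1 : R) h

theorem sum_e (v : M) : v = ∑ g, v g • e g := by
  refine funext fun h => ?_
  rw [← coef_apply h (∑ g, v g • e g), map_sum, Finset.sum_eq_single h]
  · simp [e_apply]
  · intro g _ hg
    simp [e_apply, hg.symm]
  · simp

theorem d_smul (a : R) (v : M) : d (a • v) = R.d a • v + a • d v := by
  change (∑ g, (R.d (a * v g) • e g + (a * v g) • dGen g)) =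
    R.d a • v + a • ∑ g, (R.d (v g) • e g + v g • dGen g)
  have hv : R.d a • v = ∑ g, R.d a • v g • e g := by
    rw [← Finset.smul_sum, ← sum_e]
  rw [hv, Finset.smul_sum, ← Finset.sum_add_distrib]
  refine Finset.sum_congr rfl fun g _ => ?_
  rw [Derivation.leibniz]
  simp only [smul_eq_mul, smul_add, smul_smul, add_smul]
  rw [mul_comm (v g) (R.d a)]; abel

theorem d_e (g : Gen) : d (e g) = dGen g := by
  change (∑ h, (R.d (e g h) • e h + e g h • dGen h)) = dGen g
  rw [Finset.sum_eq_single g]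
  · simp [e_apply]
  · intro h _ hh
    simp [e_apply, hh]
  · simp

theorem d_dGen (g : Gen) : d (dGen g) = 0 := by
  have h2 : (2 : R) = 0 := by
    have : ((2 : ZMod 2)) = 0 := by decide
    have := congrArg (algebraMap (ZMod 2) R) this
    rw [map_zero, map_ofNat] at this; exact this
  have h4 : (4 : R) = 0 := by linear_combination 2 * h2
  cases g <;>
  · simp only [dGen, map_add, d_smul, d_e, Derivation.leibniz, Derivation.leibniz_pow, R.d_U,
      R.d_Q, R.d_θ]
    match_scalars <;> ring_nf <;> simp only [h2, h4, mul_zero, add_zero]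

theorem e_mem (g : Gen) : e g ∈ deg g.deg := by
  intro h
  rw [e_apply]
  split_ifs with hh
  · subst hh
    rw [sub_self]
    exact SetLike.one_mem_graded _
  · exact zero_mem _

theorem smul_mem {i j : ℤ} {a : R} {v : M} (ha : a ∈ DGAlg.deg (A := R) i) (hv : v ∈ deg j) :
    a • v ∈ deg (i + j) := by
  intro h
  have := SetLike.mul_mem_graded (A := DGAlg.deg (A := R)) ha (hv h)
  rw [← add_sub_assoc] at this
  exact this

theorem smul_e_mem {i n : ℤ} {a : R} {g : Gen} (ha : a.IsWeightedHomogeneous R.weight i)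
    (h : i + g.deg = n) : a • e g ∈ deg n :=
  h ▸ smul_mem ha (e_mem g)

open R in
theorem dGen_mem (g : Gen) : dGen g ∈ deg (g.deg + 1) := by
  have hU := R.U_weight
  have hQ := R.Q_weight
  have hQ2 : (Q ^ 2).IsWeightedHomogeneous weight 2 := by simpa using R.Q_weight.pow 2
  have hθ2 : (θ ^ 2).IsWeightedHomogeneous weight 2 := by simpa using R.θ_weight.pow 2
  have hθ4 : (θ ^ 4).IsWeightedHomogeneous weight 4 := by simpa using R.θ_weight.pow 4
  have hU2 : (U ^ 2).IsWeightedHomogeneous weight 4 := by simpa using R.U_weight.pow 2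
  have h1 : (U + θ ^ 2).IsWeightedHomogeneous weight 2 := hU.add hθ2
  have h2 : (U + θ ^ 2 + Q ^ 2).IsWeightedHomogeneous weight 2 := h1.add hQ2
  have h3 : (U ^ 2 + θ ^ 4).IsWeightedHomogeneous weight 4 := hU2.add hθ4
  have h4 : (U * (U ^ 2 + θ ^ 4)).IsWeightedHomogeneous weight 6 := hU.mul h3
  have h5 : (Q ^ 2 * (U ^ 2 + θ ^ 4)).IsWeightedHomogeneous weight 6 := hQ2.mul h3
  have h6 : (U ^ 2 * (U ^ 2 + θ ^ 4)).IsWeightedHomogeneous weight 8 := hU2.mul h3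
  cases g <;> simp only [dGen, smul_add] <;>
    repeat' first
      | ((with_reducible refine smul_e_mem hU ?_); rfl)
      | ((with_reducible refine smul_e_mem hQ ?_); rfl)
      | ((with_reducible refine smul_e_mem hQ2 ?_); rfl)
      | ((with_reducible refine smul_e_mem hU2 ?_); rfl)
      | ((with_reducible refine smul_e_mem h1 ?_); rfl)
      | ((with_reducible refine smul_e_mem h2 ?_); rfl)
      | ((with_reducible refine smul_e_mem h4 ?_); rfl)
      | ((with_reducible refine smul_e_mem h5 ?_); rfl)
      | ((with_reducible refine smul_e_mem h6 ?_); rfl)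
      | with_reducible refine AddSubgroup.add_mem _ ?_ ?_

theorem d_mem {n : ℤ} {v : M} (hv : v ∈ deg n) : d v ∈ deg (n + 1) := by
  change (∑ g, (R.d (v g) • e g + v g • dGen g)) ∈ deg (n + 1)
  refine AddSubgroup.sum_mem _ fun g _ => AddSubgroup.add_mem _ ?_ ?_
  · have := smul_mem (DGAlg.d_mem (hv g)) (e_mem g)
    rwa [show n - g.deg + 1 + g.deg = n + 1 by ring] at this
  · have := smul_mem (hv g) (dGen_mem g)
    rwa [show n - g.deg + (g.deg + 1) = n + 1 by ring] at this

theorem d_d (v : M) : d (d v) = 0 := by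
  conv_lhs => rw [sum_e v]
  rw [map_sum, map_sum]
  refine Finset.sum_eq_zero fun g _ => ?_
  have h : R.d (R.d (v g)) = 0 := DGAlg.d_d (A := R) (v g)
  rw [d_smul, map_add, d_smul, d_smul, h, d_e, d_dGen, zero_smul, smul_zero, zero_add, add_zero]
  exact add_self_eq_zero' R _

theorem isInternal : DirectSum.IsInternal deg := by
  let ι : ∀ (g : Gen) (i : ℤ), (DGAlg.deg (A := R) i) →+ ⨁ n, deg n := fun g i =>
    AddMonoidHom.mk' (fun a => DirectSum.of (fun n => deg n) (i + g.deg)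
      ⟨(a : R) • e g, smul_mem a.2 (e_mem g)⟩)
      (fun a b => by rw [← map_add]; congr 1; ext1; simp [add_smul])
  let dec : M →+ ⨁ n, deg n := ∑ g : Gen,
    ((DirectSum.toAddMonoid (ι g)).comp
      (DirectSum.decomposeAddEquiv (DGAlg.deg (A := R))).toAddMonoidHom).comp
      (coef g)
  have hdec : ∀ v, dec v = ∑ g, DirectSum.toAddMonoid (ι g)
      (DirectSum.decompose (DGAlg.deg (A := R)) (v g)) := by
    intro v
    simp [dec, AddMonoidHom.finsetSum_apply]
  have hsum : ∀ (g : Gen) (a : R), DirectSum.coeAddMonoidHom deg (DirectSum.toAddMonoid (ι g)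
      (DirectSum.decompose (DGAlg.deg (A := R)) a)) = a • e g := by
    intro g a
    refine homogeneous_induction (DGAlg.isInternal R) (p := fun a =>
      DirectSum.coeAddMonoidHom deg (DirectSum.toAddMonoid (ι g)
      (DirectSum.decompose (DGAlg.deg (A := R)) a)) = a • e g) (by simp) ?_ ?_ a
    · intro i a ha
      replace ha : a ∈ DGAlg.deg (A := R) i := ha
      rw [DirectSum.decompose_of_mem _ ha, DirectSum.toAddMonoid_of]
      simp only [ι, AddMonoidHom.mk'_apply]
      rw [DirectSum.coeAddMonoidHom_of]
    · intro a b ha hb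
      rw [DirectSum.decompose_add, map_add, map_add, ha, hb, add_smul]
  refine isInternal_of_dec deg dec ?_ ?_
  · intro v
    rw [hdec, map_sum, Finset.sum_congr rfl fun g _ => hsum g (v g), ← sum_e]
  · intro n v hv
    have key : ∀ g, DirectSum.toAddMonoid (ι g) (DirectSum.decompose (DGAlg.deg (A := R)) (v g)) =
        DirectSum.of (fun n => deg n) n ⟨v g • e g, by
          have := smul_mem (hv g) (e_mem g)
          rwa [sub_add_cancel] at this⟩ := by
      intro g
      rw [DirectSum.decompose_of_mem _ (hv g), DirectSum.toAddMonoid_of]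
      simp only [ι, AddMonoidHom.mk'_apply]
      exact DirectSum.of_eq_of_gradedMonoid_eq (Sigma.subtype_ext (sub_add_cancel _ _) rfl)
    rw [hdec, Finset.sum_congr rfl fun g _ => key g, ← map_sum]
    congr 1
    ext1
    rw [AddSubgroup.val_finsetSum]
    exact (sum_e v).symm

/-- The dg `R`-module `M`. -/
instance : DGMod R M where
  deg := deg
  isInternal := isInternal
  smul_mem := smul_mem
  d := d
  d_smul := d_smul
  d_mem := d_mem
  d_d := d_d

end M

/-! ### Weak SWF-type and local maps -/

section Local

variable (N P : Type) [AddCommGroup N] [Module R N] [DGMod R N]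
variable [AddCommGroup P] [Module R P] [DGMod R P]

/-- `N` is of weak SWF-type: `R₀ ⊗ N` is quasi-isomorphic to a shift of `R₀`. As `R₀` is free over
itself, this is witnessed by a single quasi-isomorphism out of `R₀`, of some degree `n`. -/
def IsWeakSWFType : Prop :=
  ∃ (n : ℤ) (g : R₀ →ₗ[R₀] R₀ ⊗[R] N), IsQuasiIso g n

variable {N P}

/-- `f : N → P` is a local map of level `i`: it is a dg module map of degree `i` between dg modules
of weak SWF-type, and `id ⊗ f : R₀ ⊗ N → R₀ ⊗ P` is homotopic to `Q ^ i • f'` for some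
degree-preserving quasi-isomorphism `f'` of dg `R₀`-modules. The tensor products are the derived
ones for the semifree modules `R` and `M ⊗ ⋯ ⊗ M` considered here. -/
def IsLocalMap (i : ℕ) (f : N →ₗ[R] P) : Prop :=
  IsWeakSWFType N ∧ IsWeakSWFType P ∧ IsDGMap f i ∧
    ∃ f' : R₀ ⊗[R] N →ₗ[R₀] R₀ ⊗[R] P, IsQuasiIso f' 0 ∧
      AreHomotopic (f.baseChange R₀) (R₀.Q ^ i • f') i

variable (N P) in
/-- There is a local map `N → P` of level `i`. -/
def ExistsLocalMap (i : ℕ) : Prop :=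
  ∃ f : N →ₗ[R] P, IsLocalMap i f

end Local

end DG

end

/-! Let `π` be the coordinate of `x_0` on `M`. No basis element has `x_0` in its differential, so
`π` is a dg map to `R`, and its powers are dg maps on the tensor powers of `M`.

Weak SWF-type: setting `θ = 0` turns the part of the differential from the `x_j` to the `y_j` (`j ≠
0`) into a block triangular matrix with the unit `U` on its diagonal. Inverting it contracts `R₀ ⊗
M` onto a cycle `gen` with `π(gen) = 1` (`M.htpy_isContraction`). Tensoring the contraction with `N`
carries a splitting of `N` to one of `N ⊗ M` (`IsSplitting.tensor`).

Level two, criteria: a local map from `R` is determined by the cycle `z` to which it sends `1`.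
Boundaries in `R₀` are multiples of `Q ^ 3`, so comparison with `Q ^ 2 • f'` forces the monomial `Q
^ 2` into `π(z)` (`IsSplitting.not_existsLocalMap`). Conversely, a cycle of degree two with `π(z) =
Q ^ 2` gives a local map (`IsSplitting.existsLocalMap`).

Existence: `M` has a cycle of degree one with `π = Q`; its tensor square lies over `Q ^ 2`.

Obstruction: pair `d z = 0`, for `z` in the triple tensor power, with products of the coordinates of
`x_0`, of `y_{-1}` and of `y_1 + y_{-1}`. Modulo `U` and `Q ^ 3` each factor of `M` allows a factor
`θ ^ 2` to be traded for a factor `Q`. Three factors yield `θ ^ 6 π(z) = 0` in this quotient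
(`M.theta_pow_mul_mem`), and `θ` is not a zero divisor there, so `Q ^ 2` does not occur in `π(z)`.
The fourth power reduces to the third by applying `π` to the last factor. -/

noncomputable section

namespace DG

/-! ### Homogeneous primitives of homogeneous boundaries. -/

section General

variable {A : Type} [CommRing A] [Algebra (ZMod 2) A] [DGAlg A]
variable {N : Type} [AddCommGroup N] [Module A N] [DGMod A N]

/-- A homogeneous boundary is the boundary of a homogeneous element. -/
theorem exists_homogeneous_primitive {n : ℤ} {w b : N} (hw : w ∈ DGMod.deg A (n + 1))
    (hb : w = DGMod.d A b) : ∃ c ∈ DGMod.deg A (M := N) n, w = DGMod.d A c := by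
  let _ : DirectSum.Decomposition (DGMod.deg A (M := N)) :=
    DirectSum.IsInternal.chooseDecomposition _ DGMod.isInternal
  -- The differential commutes with the projections to homogeneous parts, up to the shift by one;
  -- the degree `n` part of `b` is then the primitive sought.
  have key : ∀ b : N, (DirectSum.decompose (DGMod.deg A (M := N)) (DGMod.d A b) (n + 1) : N) =
      DGMod.d A (DirectSum.decompose (DGMod.deg A (M := N)) b n : N) := by
    intro b
    refine homogeneous_induction (DGMod.isInternal (A := A) (M := N)) (p := fun b =>
      (DirectSum.decompose (DGMod.deg A (M := N)) (DGMod.d A b) (n + 1) : N) =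
      DGMod.d A (DirectSum.decompose (DGMod.deg A (M := N)) b n : N)) (by simp) ?_ ?_ b
    · intro i m hm
      by_cases h : i = n
      · subst h
        rw [DirectSum.decompose_of_mem_same _ hm, DirectSum.decompose_of_mem_same _ (DGMod.d_mem hm)]
      · rw [DirectSum.decompose_of_mem_ne _ hm h,
          DirectSum.decompose_of_mem_ne _ (DGMod.d_mem hm) (by omega), map_zero]
    · intro a b ha hb
      simp [ha, hb]
  refine ⟨_, (DirectSum.decompose (DGMod.deg A (M := N)) b n).2, ?_⟩
  rw [← key, ← hb, DirectSum.decompose_of_mem_same _ hw]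

end General

/-! ### Augmentations, splittings and their behaviour under tensor products. -/

section Augmentation

variable {N P : Type} [AddCommGroup N] [Module R N] [AddCommGroup P] [Module R P]

/-- The extension of a functional on `N` to `R₀ ⊗ N`. -/
def extend (π : N →ₗ[R] R) : R₀ ⊗[R] N →ₗ[R₀] R₀ :=
  LinearMap.liftBaseChange R₀ (Algebra.linearMap R R₀ ∘ₗ π)

@[simp] theorem extend_tmul (π : N →ₗ[R] R) (r : R₀) (n : N) :
    extend π (r ⊗ₜ[R] n) = r * algebraMap R R₀ (π n) := by
  simp [extend]

/-- The product of two functionals. -/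
def mulFunctional (α : N →ₗ[R] R) (β : P →ₗ[R] R) : N ⊗[R] P →ₗ[R] R :=
  LinearMap.mul' R R ∘ₗ TensorProduct.map α β

@[simp] theorem mulFunctional_tmul (α : N →ₗ[R] R) (β : P →ₗ[R] R) (n : N) (p : P) :
    mulFunctional α β (n ⊗ₜ[R] p) = α n * β p := rfl

/-- The exchange of factors in `(R₀ ⊗ P) ⊗ N`. -/
def exchange (N P : Type) [AddCommGroup N] [Module R N] [AddCommGroup P] [Module R P] :
    (R₀ ⊗[R] P) ⊗[R] N ≃ₗ[R] R₀ ⊗[R] (N ⊗[R] P) :=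
  TensorProduct.assoc R R₀ P N ≪≫ₗ
    TensorProduct.congr (LinearEquiv.refl R R₀) (TensorProduct.comm R P N)

@[simp] theorem exchange_tmul (r : R₀) (p : P) (n : N) :
    exchange N P ((r ⊗ₜ[R] p) ⊗ₜ[R] n) = r ⊗ₜ[R] (n ⊗ₜ[R] p) := rfl

/-- In identities proved this way the factor `R₀ ⊗ P` stays whole, so that a contraction of it,
which is not given on pure tensors, can be applied. -/
theorem exchange_induction {p : R₀ ⊗[R] (N ⊗[R] P) → Prop} (h0 : p 0)
    (hadd : ∀ v w, p v → p w → p (v + w))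
    (ht : ∀ (w : R₀ ⊗[R] P) (n : N), p (exchange N P (w ⊗ₜ[R] n)))
    (z : R₀ ⊗[R] (N ⊗[R] P)) : p z := by
  obtain ⟨t, rfl⟩ := (exchange N P).surjective z
  induction t using TensorProduct.induction_on with
  | zero => simpa using h0
  | add v w hv hw => rw [map_add]; exact hadd _ _ hv hw
  | tmul w n => exact ht w n

theorem extend_exchange (α : N →ₗ[R] R) (β : P →ₗ[R] R) (w : R₀ ⊗[R] P) (n : N) :
    extend (mulFunctional α β) (exchange N P (w ⊗ₜ[R] n)) =
      extend β w * algebraMap R R₀ (α n) := by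
  induction w using TensorProduct.induction_on with
  | zero => simp
  | add v w hv hw => simp only [TensorProduct.add_tmul, map_add, hv, hw, add_mul]
  | tmul s p =>
    rw [exchange_tmul, extend_tmul, extend_tmul, mulFunctional_tmul, map_mul]; ring

/-- The map `R₀ ⊗ N → R₀ ⊗ (N ⊗ P)` given by a cycle `y` in `R₀ ⊗ P`. -/
def insert (N : Type) [AddCommGroup N] [Module R N] (y : R₀ ⊗[R] P) :
    R₀ ⊗[R] N →ₗ[R] R₀ ⊗[R] (N ⊗[R] P) :=
  (exchange N P).toLinearMap ∘ₗ
    (((LinearMap.toSpanSingleton R₀ (R₀ ⊗[R] P) y).restrictScalars R).rTensor N)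

theorem insert_tmul (y : R₀ ⊗[R] P) (r : R₀) (n : N) :
    insert N y (r ⊗ₜ[R] n) = exchange N P ((r • y) ⊗ₜ[R] n) := rfl

theorem extend_insert {α : N →ₗ[R] R} {β : P →ₗ[R] R} {y : R₀ ⊗[R] P} (hy : extend β y = 1)
    (w : R₀ ⊗[R] N) : extend (mulFunctional α β) (insert N y w) = extend α w := by
  induction w using TensorProduct.induction_on with
  | zero => simp
  | add v w hv hw => simp only [map_add, hv, hw]
  | tmul s p =>
    rw [insert_tmul, extend_exchange, map_smul, hy, extend_tmul, smul_eq_mul, mul_one]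

/-- The map `R₀ ⊗ (N ⊗ P) → R₀ ⊗ N` given by a functional on `P`. -/
def contract (N : Type) [AddCommGroup N] [Module R N] (β : P →ₗ[R] R) :
    R₀ ⊗[R] (N ⊗[R] P) →ₗ[R] R₀ ⊗[R] N :=
  ((extend β).restrictScalars R).rTensor N ∘ₗ (exchange N P).symm.toLinearMap

theorem contract_exchange (β : P →ₗ[R] R) (w : R₀ ⊗[R] P) (n : N) :
    contract N β (exchange N P (w ⊗ₜ[R] n)) = extend β w ⊗ₜ[R] n := by
  simp [contract]

theorem extend_contract (α : N →ₗ[R] R) (β : P →ₗ[R] R) (z : R₀ ⊗[R] (N ⊗[R] P)) :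
    extend α (contract N β z) = extend (mulFunctional α β) z := by
  induction z using exchange_induction with
  | h0 => simp
  | hadd v w hv hw => simp only [map_add, hv, hw]
  | ht w n => rw [contract_exchange, extend_exchange, extend_tmul]

variable [DGMod R N] [DGMod R P]

theorem extend_d {π : N →ₗ[R] R} (h : IsChainMap π) (w : R₀ ⊗[R] N) :
    extend π (DGMod.d R₀ w) = DGAlg.d (extend π w) := by
  induction w using TensorProduct.induction_on with
  | zero => simp
  | add v w hv hw => simp only [map_add, hv, hw]
  | tmul r n =>
    have e : algebraMap R R₀ (DGMod.d R (π n)) = DGAlg.d (algebraMap R R₀ (π n)) :=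
      DGExt.map_d (π n)
    rw [baseChange_d_tmul, map_add, extend_tmul, extend_tmul, extend_tmul, h n, e,
      Derivation.leibniz]
    simp only [smul_eq_mul]
    ring

theorem baseChange_deg_induction {p : R₀ ⊗[R] N → Prop} {n : ℤ} (h0 : p 0)
    (hadd : ∀ v w, p v → p w → p (v + w))
    (ht : ∀ (i j : ℤ) (r : R₀) (m : N), i + j = n → r ∈ DGAlg.deg i → m ∈ DGMod.deg R j →
      p (r ⊗ₜ[R] m)) {w : R₀ ⊗[R] N} (hw : w ∈ DGMod.deg R₀ n) : p w := by
  let _ := restrictDGMod R R₀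
  change w ∈ tensorDeg (A := R) R₀ N n at hw
  induction hw using AddSubgroup.closure_induction with
  | mem z hz =>
    obtain ⟨i, j, x, y, h, hx, hy, rfl⟩ := hz
    exact ht i j x y h hx hy
  | zero => exact h0
  | add z w hz hw ihz ihw => exact hadd _ _ ihz ihw
  | neg z hz ihz => rwa [neg_eq_of_add_eq_zero_left (add_self_eq_zero' R z)]

theorem tmul_mem_deg {i j n : ℤ} {r : R₀} {m : N} (h : i + j = n) (hr : r ∈ DGAlg.deg i)
    (hm : m ∈ DGMod.deg R j) : r ⊗ₜ[R] m ∈ DGMod.deg R₀ (M := R₀ ⊗[R] N) n :=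
  letI := restrictDGMod R R₀
  tmul_mem_tensorDeg (A := R) (M := R₀) h hr hm

theorem extend_mem {π : N →ₗ[R] R} (h : HasDegree π 0) {n : ℤ} {w : R₀ ⊗[R] N}
    (hw : w ∈ DGMod.deg R₀ n) : extend π w ∈ DGAlg.deg (A := R₀) n := by
  refine baseChange_deg_induction (p := fun w => extend π w ∈ DGAlg.deg (A := R₀) n)
    (by simp) (fun v w hv hw => by rw [map_add]; exact add_mem hv hw) ?_ hw
  intro i j r m hij hr hm
  rw [extend_tmul, ← hij]
  have := h j m hm
  rw [add_zero] at this
  exact SetLike.mul_mem_graded hr (DGExt.map_mem this)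

/-- `y` is a cycle of degree zero in `R₀ ⊗ N` which splits the extension of the dg module map `π`,
and the kernel of that extension is acyclic. -/
structure IsSplitting (π : N →ₗ[R] R) (y : R₀ ⊗[R] N) : Prop where
  isDGMap : IsDGMap π 0
  mem : y ∈ DGMod.deg R₀ 0
  d_eq : DGMod.d R₀ y = 0
  extend_eq : extend π y = 1
  acyclic : ∀ w : R₀ ⊗[R] N, DGMod.d R₀ w = 0 → extend π w = 0 → ∃ b, w = DGMod.d R₀ b

/-- `extend π` is a chain map left inverse to `r ↦ r • y`, which gives injectivity on cohomology.
For a cycle `w`, the difference `w - π(w) • y` is a cycle in the kernel of `extend π`, hence a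
boundary, which gives surjectivity. -/
theorem IsSplitting.isQuasiIso {π : N →ₗ[R] R} {y : R₀ ⊗[R] N} (h : IsSplitting π y) :
    IsQuasiIso (LinearMap.toSpanSingleton R₀ (R₀ ⊗[R] N) y) 0 := by
  have hd : ∀ r : R₀, DGMod.d R₀ (r • y) = DGAlg.d r • y := fun r => by
    rw [DGMod.d_smul, h.d_eq, smul_zero, add_zero]
  refine ⟨⟨fun n m hm => DGMod.smul_mem hm h.mem, fun r => (hd r).symm⟩, ?_, ?_⟩
  · rintro r - ⟨b, hb⟩
    refine ⟨extend π b, ?_⟩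
    have := congrArg (extend π) hb
    rw [extend_d h.isDGMap.2, LinearMap.toSpanSingleton_apply, map_smul, h.extend_eq, smul_eq_mul,
      mul_one] at this
    exact this
  · intro w hw
    have hw' : DGAlg.d (extend π w) = 0 := by rw [← extend_d h.isDGMap.2, hw, map_zero]
    refine ⟨extend π w, hw', ?_⟩
    obtain ⟨b, hb⟩ := h.acyclic (w - extend π w • y) (by rw [map_sub, hd, hw, hw', zero_smul,
      sub_zero]) (by rw [map_sub, map_smul, h.extend_eq, smul_eq_mul, mul_one, sub_self])
    exact ⟨b, by rw [← hb]; simp⟩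

theorem IsSplitting.isWeakSWFType {π : N →ₗ[R] R} {y : R₀ ⊗[R] N} (h : IsSplitting π y) :
    IsWeakSWFType N :=
  ⟨0, _, h.isQuasiIso⟩

/-- A chain contraction of `R₀ ⊗ N` onto the span of `y`. -/
def IsContraction (π : N →ₗ[R] R) (y : R₀ ⊗[R] N) (h : R₀ ⊗[R] N →ₗ[R] R₀ ⊗[R] N) : Prop :=
  ∀ w, DGMod.d R₀ (h w) + h (DGMod.d R₀ w) = w + extend π w • y

theorem mulFunctional_isDGMap {α : N →ₗ[R] R} {β : P →ₗ[R] R} (hα : IsDGMap α 0)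
    (hβ : IsDGMap β 0) : IsDGMap (mulFunctional α β) 0 := by
  constructor
  · intro n z hz
    change z ∈ tensorDeg (A := R) N P n at hz
    induction hz using AddSubgroup.closure_induction with
    | mem z hz =>
      obtain ⟨i, j, x, y, rfl, hx, hy, rfl⟩ := hz
      have h1 := hα.1 i x hx
      have h2 := hβ.1 j y hy
      rw [add_zero] at h1 h2 ⊢
      exact SetLike.mul_mem_graded (A := DGAlg.deg (A := R)) h1 h2
    | zero => rw [map_zero]; exact zero_mem _
    | add z w hz hw ihz ihw => rw [map_add]; exact add_mem ihz ihw
    | neg z hz ihz => rw [map_neg]; exact neg_mem ihz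
  · intro z
    induction z using TensorProduct.induction_on with
    | zero => simp
    | add v w hv hw => simp only [map_add, hv, hw]
    | tmul n p =>
      change mulFunctional α β (DGMod.d R n ⊗ₜ[R] p + n ⊗ₜ[R] DGMod.d R p) = DGAlg.d (α n * β p)
      have e1 : α (DGMod.d R n) = DGAlg.d (α n) := hα.2 n
      have e2 : β (DGMod.d R p) = DGAlg.d (β p) := hβ.2 p
      rw [map_add, mulFunctional_tmul, mulFunctional_tmul, e1, e2, Derivation.leibniz]
      simp only [smul_eq_mul]
      ring

theorem exchange_d (w : R₀ ⊗[R] P) (n : N) :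
    DGMod.d R₀ (exchange N P (w ⊗ₜ[R] n)) =
      exchange N P (DGMod.d R₀ w ⊗ₜ[R] n) + exchange N P (w ⊗ₜ[R] DGMod.d R n) := by
  induction w using TensorProduct.induction_on with
  | zero => simp
  | add v w hv hw => simp only [TensorProduct.add_tmul, map_add, hv, hw]; abel
  | tmul s p =>
    rw [exchange_tmul, baseChange_d_tmul, baseChange_d_tmul, TensorProduct.add_tmul, map_add,
      exchange_tmul, exchange_tmul, exchange_tmul]
    change _ + s ⊗ₜ[R] tensorD (A := R) N P (n ⊗ₜ[R] p) = _
    rw [tensorD_tmul, TensorProduct.tmul_add]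
    abel

theorem exchange_mem {i j : ℤ} {w : R₀ ⊗[R] P} {n : N} (hw : w ∈ DGMod.deg R₀ i)
    (hn : n ∈ DGMod.deg R j) :
    exchange N P (w ⊗ₜ[R] n) ∈ DGMod.deg R₀ (i + j) := by
  refine baseChange_deg_induction
    (p := fun w => exchange N P (w ⊗ₜ[R] n) ∈ DGMod.deg R₀ (i + j)) (by simp)
    (fun v w hv hw => by rw [TensorProduct.add_tmul, map_add]; exact add_mem hv hw) ?_ hw
  intro k l r p hkl hr hp
  exact tmul_mem_deg (j := j + l) (by omega) hr (tmul_mem_tensorDeg rfl hn hp)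

theorem insert_d {y : R₀ ⊗[R] P} (hy : DGMod.d R₀ y = 0) (w : R₀ ⊗[R] N) :
    DGMod.d R₀ (insert N y w) = insert N y (DGMod.d R₀ w) := by
  induction w using TensorProduct.induction_on with
  | zero => simp
  | add v w hv hw => simp only [map_add, hv, hw]
  | tmul s p =>
    rw [baseChange_d_tmul, map_add, insert_tmul, insert_tmul, insert_tmul, exchange_d,
      DGMod.d_smul, hy, smul_zero, add_zero]

theorem insert_mem {y : R₀ ⊗[R] P} (hy : y ∈ DGMod.deg R₀ 0) {n : ℤ} {w : R₀ ⊗[R] N}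
    (hw : w ∈ DGMod.deg R₀ n) : insert N y w ∈ DGMod.deg R₀ n := by
  refine baseChange_deg_induction (p := fun w => insert N y w ∈ DGMod.deg R₀ n) (by simp)
    (fun v w hv hw => by rw [map_add]; exact add_mem hv hw) ?_ hw
  intro k l r p hkl hr hp
  rw [insert_tmul, ← hkl, ← add_zero k]
  exact exchange_mem (DGMod.smul_mem hr hy) hp

theorem contract_d {β : P →ₗ[R] R} (hβ : IsChainMap β) (z : R₀ ⊗[R] (N ⊗[R] P)) :
    contract N β (DGMod.d R₀ z) = DGMod.d R₀ (contract N β z) := by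
  induction z using exchange_induction with
  | h0 => simp
  | hadd v w hv hw => simp only [map_add, hv, hw]
  | ht w n =>
    rw [exchange_d, map_add, contract_exchange, contract_exchange, contract_exchange,
      baseChange_d_tmul, extend_d hβ]

/-- A splitting of `N` and a contraction of `R₀ ⊗ P` give a splitting of `N ⊗ P`. -/
theorem IsSplitting.tensor {α : N →ₗ[R] R} {β : P →ₗ[R] R} {x : R₀ ⊗[R] N} {y : R₀ ⊗[R] P}
    {h : R₀ ⊗[R] P →ₗ[R] R₀ ⊗[R] P} (hx : IsSplitting α x) (hβ : IsDGMap β 0)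
    (hy : y ∈ DGMod.deg R₀ 0) (hyd : DGMod.d R₀ y = 0) (hβy : extend β y = 1)
    (hh : IsContraction β y h) : IsSplitting (mulFunctional α β) (insert N y x) where
  isDGMap := mulFunctional_isDGMap hx.isDGMap hβ
  mem := insert_mem hy hx.mem
  d_eq := by rw [insert_d hyd, hx.d_eq, map_zero]
  extend_eq := by rw [extend_insert hβy, hx.extend_eq]
  acyclic := by
    intro z hz hpz
    -- The contraction acts on the factor `R₀ ⊗ P` of `(R₀ ⊗ P) ⊗ N`. For this it need only be
    -- `R`-linear.
    let H : R₀ ⊗[R] (N ⊗[R] P) →ₗ[R] R₀ ⊗[R] (N ⊗[R] P) :=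
      (exchange N P).toLinearMap ∘ₗ h.rTensor N ∘ₗ (exchange N P).symm.toLinearMap
    have hH : ∀ w n, H (exchange N P (w ⊗ₜ[R] n)) = exchange N P (h w ⊗ₜ[R] n) := by
      intro w n; simp [H]
    -- `H` is a homotopy between the identity and `insert ∘ contract`: the terms `h w ⊗ d n` occur
    -- twice and cancel in characteristic two.
    have key : ∀ z, DGMod.d R₀ (H z) + H (DGMod.d R₀ z) = z + insert N y (contract N β z) := by
      intro z
      induction z using exchange_induction with
      | h0 => simp
      | hadd v w hv hw =>
        simp only [map_add]
        rw [add_add_add_comm, hv, hw, add_add_add_comm]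
      | ht w n =>
        rw [hH, exchange_d, exchange_d, map_add, hH, hH, contract_exchange, insert_tmul,
          add_add_add_comm, add_self_eq_zero' R (exchange N P (h w ⊗ₜ[R] DGMod.d R n)), add_zero,
          ← map_add, ← map_add, ← TensorProduct.add_tmul, ← TensorProduct.add_tmul, hh w]
    -- The contracted cycle lies in the kernel of `extend α`, so it bounds in `R₀ ⊗ N`; the homotopy
    -- transports this back to `z`.
    obtain ⟨b, hb⟩ := hx.acyclic (contract N β z) (by rw [← contract_d hβ.2, hz, map_zero])
      (by rw [extend_contract, hpz])
    have hk := key z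
    rw [hz, map_zero, add_zero, hb, ← insert_d hyd] at hk
    refine ⟨H z + insert N y b, ?_⟩
    rw [map_add, hk, add_assoc, add_self_eq_zero' R, add_zero]

end Augmentation

/-! ### Characteristic two and the inverse of `U`. -/

theorem R₀.two_eq_zero : (2 : R₀) = 0 := by
  have := congrArg (algebraMap (ZMod 2) R₀) (show (2 : ZMod 2) = 0 by decide)
  rwa [map_zero, map_ofNat] at this

theorem R.two_eq_zero : (2 : R) = 0 := by
  have := congrArg (algebraMap (ZMod 2) R) (show (2 : ZMod 2) = 0 by decide)
  rwa [map_zero, map_ofNat] at this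

namespace R₀

/-- The inverse of `U`. -/
def Uinv : R₀ := mono 0 (-1)

theorem Uinv_mul_U : Uinv * U = 1 := by
  simp [Uinv, U, mono_mul, mono_zero]

theorem d_Uinv : d Uinv = Q ^ 3 * Uinv ^ 2 := by
  have : ((-1 : ℤ) : ZMod 2) = 1 := by decide
  simp [Uinv, d_mono, Q, pow_succ, mono_mul]

theorem Uinv_mem : Uinv ∈ DGAlg.deg (A := R₀) (-2) := by
  have h := mono_mem 0 (-1)
  norm_num at h
  exact h

theorem algebraMap_U : algebraMap R R₀ R.U = U := by simp [algebraMap_R, R.U]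
theorem algebraMap_Q : algebraMap R R₀ R.Q = Q := by simp [algebraMap_R, R.Q]
theorem algebraMap_θ : algebraMap R R₀ R.θ = 0 := by simp [algebraMap_R, R.θ]

end R₀

/-! ### The contraction of `R₀ ⊗ M` onto a cycle over `1`. -/

namespace M

/-- The basis elements of `R₀ ⊗ M`. -/
def E (g : Gen) : R₀ ⊗[R] M := 1 ⊗ₜ[R] e g

theorem tmul_smul_e (r : R₀) (a : R) (g : Gen) :
    r ⊗ₜ[R] (a • e g) = (r * algebraMap R R₀ a) • E g := by
  rw [E, TensorProduct.smul_tmul', smul_eq_mul, mul_one, ← TensorProduct.smul_tmul,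
    Algebra.smul_def, mul_comm]

theorem baseChange_induction {p : R₀ ⊗[R] M → Prop} (h0 : p 0)
    (hadd : ∀ v w, p v → p w → p (v + w)) (ht : ∀ (r : R₀) (g : Gen), p (r • E g))
    (w : R₀ ⊗[R] M) : p w := by
  induction w using TensorProduct.induction_on with
  | zero => exact h0
  | add v w hv hw => exact hadd v w hv hw
  | tmul r v =>
    rw [sum_e v, TensorProduct.tmul_sum]
    exact Finset.sum_induction _ p hadd h0 fun g _ => by rw [tmul_smul_e]; exact ht _ _

/-- The differential of `R₀ ⊗ M` on the basis elements. -/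
theorem d_E (g : Gen) : DGMod.d R₀ (E g) = (1 : R₀) ⊗ₜ[R] dGen g := by
  have h : DGMod.d R (e g) = dGen g := d_e g
  rw [E, baseChange_d_tmul, h, Derivation.map_one_eq_zero, TensorProduct.zero_tmul, zero_add]

theorem E_mem (g : Gen) : E g ∈ DGMod.deg R₀ g.deg :=
  tmul_mem_deg (zero_add _) (SetLike.one_mem_graded _) (e_mem g)

section Step

variable {A W : Type} [CommRing A] [AddCommGroup W] [Module A W]

/-- One step of the inversion of the block triangular matrix which describes the differential:
the preimages of a pair of basis elements, from those (`k`) of the next pair. -/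
def step (u q a b : A) (x x' : W) (k : W × W) : W × W :=
  (u • (x + a • k.1 + q ^ 2 • (u • (x' + a • k.2)) + b • k.2), u • (x' + a • k.2))

/-- With `step_fst`, this is back substitution in the triangular system. It becomes the identity
`htpy (d x) = x` on the `x_j`, `j ≠ 0`. -/
theorem step_snd {u U q a b : A} (hu : u * U = 1) (h2 : (2 : A) = 0) (x x' : W) (k : W × W) :
    U • (step u q a b x x' k).2 + a • k.2 = x' := by
  simp only [step]
  match_scalars <;> grind

theorem step_fst {u U q a b : A} (hu : u * U = 1) (h2 : (2 : A) = 0) (x x' : W) (k : W × W) :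
    U • (step u q a b x x' k).1 + a • k.1 + q ^ 2 • (step u q a b x x' k).2 + b • k.2 = x := by
  simp only [step]
  match_scalars <;> grind

end Step

section Contraction

open R₀

theorem d_Q_sq : DGAlg.d (Q ^ 2) = 0 := by
  have : DGAlg.d Q = 0 := d_Q
  rw [Derivation.leibniz_pow, this, smul_zero, smul_zero]

variable {W : Type} [AddCommGroup W] [Module R₀ W] [DGMod R₀ W]

/-- The condition `d a = Q * b` is what `d (d x') = 0` imposes on the coefficient of `z'`. The
conclusion has the shape needed for a contraction: its `Q`-term cancels against the contraction
applied to `d y = Q • (y + y')`. -/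
theorem step_d {a b : R₀} {x x' y y' z z' : W} {k : W × W} (ha : DGAlg.d a = Q * b)
    (hb : DGAlg.d b = 0)
    (hx : DGMod.d R₀ x = U • y + a • z + Q ^ 2 • y' + b • z' + Q • (x + x'))
    (hx' : DGMod.d R₀ x' = U • y' + a • z' + Q • (x + x'))
    (hk : DGMod.d R₀ k.1 = z + Q • (k.1 + k.2)) (hk' : DGMod.d R₀ k.2 = z' + Q • (k.1 + k.2)) :
    DGMod.d R₀ (step Uinv Q a b x x' k).1 =
        y + Q • ((step Uinv Q a b x x' k).1 + (step Uinv Q a b x x' k).2) ∧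
      DGMod.d R₀ (step Uinv Q a b x x' k).2 =
        y' + Q • ((step Uinv Q a b x x' k).1 + (step Uinv Q a b x x' k).2) := by
  have hu := Uinv_mul_U
  have h2 := R₀.two_eq_zero
  have hq := d_Q_sq
  have hud : DGAlg.d Uinv = Q ^ 3 * Uinv ^ 2 := d_Uinv
  simp only [step, DGMod.d_smul, map_add, ha, hb, hx, hx', hk, hk', hq, hud]
  -- What remains is an identity of coefficients in a commutative ring, following from `u * U = 1`
  -- and `2 = 0`.
  generalize Uinv = u at *
  generalize (U : R₀) = U at *
  generalize (Q : R₀) = q at *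
  clear hx hx' hk hk' ha hb hq hud
  constructor
  · match_scalars <;> grind
  · match_scalars <;> grind

theorem step_mem {a b : R₀} {x x' : W} {k : W × W} {i j n m : ℤ} (ha : a ∈ DGAlg.deg i)
    (hb : b ∈ DGAlg.deg i) (hij : i + j = n) (hm : n - 2 = m)
    (hx : x ∈ DGMod.deg R₀ n)
    (hx' : x' ∈ DGMod.deg R₀ n) (hk : k.1 ∈ DGMod.deg R₀ j) (hk' : k.2 ∈ DGMod.deg R₀ j) :
    (step Uinv Q a b x x' k).1 ∈ DGMod.deg R₀ m ∧
      (step Uinv Q a b x x' k).2 ∈ DGMod.deg R₀ m := by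
  have hs : ∀ {c : R₀} {w : W}, c ∈ DGAlg.deg i → w ∈ DGMod.deg R₀ j →
      c • w ∈ DGMod.deg R₀ n := fun hc hw => hij ▸ DGMod.smul_mem hc hw
  have hu : ∀ {w : W}, w ∈ DGMod.deg R₀ n → Uinv • w ∈ DGMod.deg R₀ m := fun hw => by
    have := DGMod.smul_mem Uinv_mem hw
    rwa [neg_add_eq_sub, hm] at this
  have h2 : Uinv • (x' + a • k.2) ∈ DGMod.deg R₀ m := hu (add_mem hx' (hs ha hk'))
  have hq : Q ^ 2 ∈ DGAlg.deg (A := R₀) 2 := SetLike.pow_mem_graded 2 Q_mem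
  have h3 : Q ^ 2 • (Uinv • (x' + a • k.2)) ∈ DGMod.deg R₀ n := by
    have := DGMod.smul_mem hq h2
    rwa [← hm, add_sub_cancel] at this
  exact ⟨hu (add_mem (add_mem (add_mem hx (hs ha hk)) h3) (hs hb hk')), h2⟩

open Gen

/-- The right side is written `Q * 0` to fit the hypothesis `d a = Q * b` of `step_d` with `b = 0`.
-/
theorem d_U_pow_two_mul (n : ℕ) : DGAlg.d (U ^ (2 * n)) = Q * 0 := by
  rw [Derivation.leibniz_pow, mul_nsmul, ← Nat.cast_smul_eq_nsmul R₀ 2, Nat.cast_ofNat,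
    R₀.two_eq_zero, zero_smul, smul_zero, mul_zero]

/-- Preimages of the pairs `y_j`, `y_{-j}` under the differential modulo the terms with `Q`. -/
def pre5 : (R₀ ⊗[R] M) × (R₀ ⊗[R] M) := step Uinv Q 0 0 (E xp5) (E xm5) 0

/-- The preimages of `y_4`, `y_{-4}`; see `pre5`. -/
def pre4 : (R₀ ⊗[R] M) × (R₀ ⊗[R] M) := step Uinv Q (U ^ 4) 0 (E xp4) (E xm4) pre5

/-- The preimages of `y_3`, `y_{-3}`; see `pre5`. -/
def pre3 : (R₀ ⊗[R] M) × (R₀ ⊗[R] M) :=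
  step Uinv Q (U ^ 3) (Q ^ 2 * U ^ 2) (E xp3) (E xm3) pre4

/-- The preimages of `y_2`, `y_{-2}`; see `pre5`. -/
def pre2 : (R₀ ⊗[R] M) × (R₀ ⊗[R] M) := step Uinv Q (U ^ 2) 0 (E xp2) (E xm2) pre3

/-- The preimages of `y_1`, `y_{-1}`; see `pre5`. -/
def pre1 : (R₀ ⊗[R] M) × (R₀ ⊗[R] M) := step Uinv Q U (Q ^ 2) (E xp1) (E xm1) pre2

/-- The contraction on the basis elements. -/
def htpyGen : Gen → R₀ ⊗[R] M
  | x0 | xp1 | xp2 | xp3 | xp4 | xp5 | xm1 | xm2 | xm3 | xm4 | xm5 => 0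
  | yp1 => pre1.1 | ym1 => pre1.2
  | yp2 => pre2.1 | ym2 => pre2.2
  | yp3 => pre3.1 | ym3 => pre3.2
  | yp4 => pre4.1 | ym4 => pre4.2
  | yp5 => pre5.1 | ym5 => pre5.2

/-- The coordinate functionals on `M`. -/
def coord (g : Gen) : M →ₗ[R] R where
  toFun v := v g
  map_add' _ _ := rfl
  map_smul' _ _ := rfl

/-- The contraction of `R₀ ⊗ M`. -/
def htpy : R₀ ⊗[R] M →ₗ[R₀] R₀ ⊗[R] M :=
  LinearMap.liftBaseChange R₀ (∑ g, (coord g).smulRight (htpyGen g))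

theorem htpy_E (g : Gen) : htpy (E g) = htpyGen g := by
  rw [htpy, E, LinearMap.liftBaseChange_tmul, one_smul, LinearMap.sum_apply,
    Finset.sum_eq_single g]
  · simp [coord, e_apply]
  · intro h _ hh
    simp [coord, e_apply, hh]
  · simp

theorem coord_d (g : Gen) (v : M) :
    coord g (DGMod.d R v) = R.d (coord g v) + ∑ h, v h * dGen h g := by
  change coef g (∑ h, (R.d (v h) • e h + v h • dGen h)) = R.d (v g) + _
  rw [map_sum, Finset.sum_congr rfl fun h _ => map_add _ _ _, Finset.sum_add_distrib]
  simp only [coef_apply, smul_apply, e_apply]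
  simp

theorem coord_x0_isDGMap : IsDGMap (coord x0) 0 := by
  constructor
  · intro n m hm
    have := hm x0
    rw [Gen.deg, sub_zero] at this
    rwa [add_zero]
  · intro m
    rw [coord_d]
    refine (add_eq_left.2 (Finset.sum_eq_zero fun h _ => ?_)).trans rfl
    cases h <;> simp [dGen, e_apply]

/-- The generator of the cohomology of `R₀ ⊗ M`. -/
def gen : R₀ ⊗[R] M := E x0 + htpy (DGMod.d R₀ (E x0))

theorem extend_E (g : Gen) : extend (coord x0) (E g) = if g = x0 then 1 else 0 := by
  rw [E, extend_tmul, one_mul]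
  change algebraMap R R₀ (e g x0) = _
  rw [e_apply]
  split_ifs with h1 h2 h2 <;> simp_all

/-- The vanishing summands pad the formulas to the common shape of `step_d`. As `θ ↦ 0`, both `U + θ
^ 2` and `U` become `U`, and `U ^ 2 + θ ^ 4` becomes `U ^ 2`. -/
theorem d_Ex :
    (DGMod.d R₀ (E x0) = U • E yp1 + (U + Q ^ 2) • E ym1) ∧
    (DGMod.d R₀ (E xp1) = U • E yp1 + U • E yp2 + Q ^ 2 • E ym1 + Q ^ 2 • E ym2
      + Q • (E xp1 + E xm1)) ∧
    (DGMod.d R₀ (E xm1) = U • E ym1 + U • E ym2 + Q • (E xp1 + E xm1)) ∧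
    (DGMod.d R₀ (E xp2) = U • E yp2 + U ^ 2 • E yp3 + Q ^ 2 • E ym2 + (0 : R₀) • E ym3
      + Q • (E xp2 + E xm2)) ∧
    (DGMod.d R₀ (E xm2) = U • E ym2 + U ^ 2 • E ym3 + Q • (E xp2 + E xm2)) ∧
    (DGMod.d R₀ (E xp3) = U • E yp3 + U ^ 3 • E yp4 + Q ^ 2 • E ym3 + (Q ^ 2 * U ^ 2) • E ym4
      + Q • (E xp3 + E xm3)) ∧
    (DGMod.d R₀ (E xm3) = U • E ym3 + U ^ 3 • E ym4 + Q • (E xp3 + E xm3)) ∧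
    (DGMod.d R₀ (E xp4) = U • E yp4 + U ^ 4 • E yp5 + Q ^ 2 • E ym4 + (0 : R₀) • E ym5
      + Q • (E xp4 + E xm4)) ∧
    (DGMod.d R₀ (E xm4) = U • E ym4 + U ^ 4 • E ym5 + Q • (E xp4 + E xm4)) ∧
    (DGMod.d R₀ (E xp5) = U • E yp5 + (0 : R₀) • (0 : R₀ ⊗[R] M) + Q ^ 2 • E ym5
      + (0 : R₀) • (0 : R₀ ⊗[R] M) + Q • (E xp5 + E xm5)) ∧
    (DGMod.d R₀ (E xm5) = U • E ym5 + (0 : R₀) • (0 : R₀ ⊗[R] M) + Q • (E xp5 + E xm5)) := by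
  refine ⟨?_, ?_, ?_, ?_, ?_, ?_, ?_, ?_, ?_, ?_, ?_⟩ <;>
  · simp only [d_E, dGen, TensorProduct.tmul_add, tmul_smul_e, smul_add, map_add, map_mul, map_pow,
      algebraMap_U, algebraMap_Q, algebraMap_θ, one_mul]
    try module

theorem d_Ey :
    (DGMod.d R₀ (E yp1) = Q • (E yp1 + E ym1) ∧ DGMod.d R₀ (E ym1) = Q • (E yp1 + E ym1)) ∧
    (DGMod.d R₀ (E yp2) = Q • (E yp2 + E ym2) ∧ DGMod.d R₀ (E ym2) = Q • (E yp2 + E ym2)) ∧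
    (DGMod.d R₀ (E yp3) = Q • (E yp3 + E ym3) ∧ DGMod.d R₀ (E ym3) = Q • (E yp3 + E ym3)) ∧
    (DGMod.d R₀ (E yp4) = Q • (E yp4 + E ym4) ∧ DGMod.d R₀ (E ym4) = Q • (E yp4 + E ym4)) ∧
    (DGMod.d R₀ (E yp5) = Q • (E yp5 + E ym5) ∧ DGMod.d R₀ (E ym5) = Q • (E yp5 + E ym5)) := by
  refine ⟨⟨?_, ?_⟩, ⟨?_, ?_⟩, ⟨?_, ?_⟩, ⟨?_, ?_⟩, ?_, ?_⟩ <;>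
  · simp only [d_E, dGen, TensorProduct.tmul_add, tmul_smul_e, smul_add, algebraMap_Q, one_mul]

theorem d_pre5 : DGMod.d R₀ pre5.1 = E yp5 + Q • (pre5.1 + pre5.2) ∧
    DGMod.d R₀ pre5.2 = E ym5 + Q • (pre5.1 + pre5.2) := by
  obtain ⟨-, -, -, -, -, -, -, -, -, hx, hx'⟩ := d_Ex
  exact step_d (k := 0) (by simp) (by simp) hx hx' (by simp) (by simp)

theorem d_pre4 : DGMod.d R₀ pre4.1 = E yp4 + Q • (pre4.1 + pre4.2) ∧
    DGMod.d R₀ pre4.2 = E ym4 + Q • (pre4.1 + pre4.2) := by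
  obtain ⟨-, -, -, -, -, -, -, hx, hx', -, -⟩ := d_Ex
  exact step_d (d_U_pow_two_mul 2) (by simp) hx hx' d_pre5.1 d_pre5.2

theorem d_pre3 : DGMod.d R₀ pre3.1 = E yp3 + Q • (pre3.1 + pre3.2) ∧
    DGMod.d R₀ pre3.2 = E ym3 + Q • (pre3.1 + pre3.2) := by
  obtain ⟨-, -, -, -, -, hx, hx', -, -, -, -⟩ := d_Ex
  refine step_d ?_ ?_ hx hx' d_pre4.1 d_pre4.2
  · have h1 : DGAlg.d U = Q ^ 3 := d_U
    have h2 := d_U_pow_two_mul 1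
    rw [pow_succ, Derivation.leibniz, h1, h2]
    simp only [smul_eq_mul]; ring
  · rw [Derivation.leibniz, d_Q_sq, d_U_pow_two_mul 1]; simp

theorem d_pre2 : DGMod.d R₀ pre2.1 = E yp2 + Q • (pre2.1 + pre2.2) ∧
    DGMod.d R₀ pre2.2 = E ym2 + Q • (pre2.1 + pre2.2) := by
  obtain ⟨-, -, -, hx, hx', -, -, -, -, -, -⟩ := d_Ex
  exact step_d (d_U_pow_two_mul 1) (by simp) hx hx' d_pre3.1 d_pre3.2

theorem d_pre1 : DGMod.d R₀ pre1.1 = E yp1 + Q • (pre1.1 + pre1.2) ∧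
    DGMod.d R₀ pre1.2 = E ym1 + Q • (pre1.1 + pre1.2) := by
  obtain ⟨-, hx, hx', -, -, -, -, -, -, -, -⟩ := d_Ex
  have h1 : DGAlg.d U = Q ^ 3 := d_U
  exact step_d (by rw [h1]; ring) d_Q_sq hx hx' d_pre2.1 d_pre2.2

theorem htpy_d_Ex {x x' y y' z z' : R₀ ⊗[R] M} {k : (R₀ ⊗[R] M) × (R₀ ⊗[R] M)} {a b : R₀}
    (hx : DGMod.d R₀ x = U • y + a • z + Q ^ 2 • y' + b • z' + Q • (x + x'))
    (hx' : DGMod.d R₀ x' = U • y' + a • z' + Q • (x + x')) (h0 : htpy x = 0) (h0' : htpy x' = 0)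
    (hy : htpy y = (step Uinv Q a b x x' k).1) (hy' : htpy y' = (step Uinv Q a b x x' k).2)
    (hz : htpy z = k.1) (hz' : htpy z' = k.2) :
    htpy (DGMod.d R₀ x) = x ∧ htpy (DGMod.d R₀ x') = x' := by
  constructor
  · simp only [hx, map_add, map_smul, h0, h0', hy, hy', hz, hz', add_zero, smul_zero]
    exact step_fst Uinv_mul_U R₀.two_eq_zero x x' k
  · simp only [hx', map_add, map_smul, h0, h0', hy', hz', add_zero, smul_zero]
    exact step_snd Uinv_mul_U R₀.two_eq_zero x x' k

theorem htpy_d_E {g : Gen} (hg : g ∉ ({x0, yp1, ym1, yp2, ym2, yp3, ym3, yp4, ym4, yp5, ym5} :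
    Finset Gen)) : htpy (DGMod.d R₀ (E g)) = E g := by
  obtain ⟨-, h1, h1', h2, h2', h3, h3', h4, h4', h5, h5'⟩ := d_Ex
  have H1 := htpy_d_Ex (k := pre2) h1 h1' (htpy_E _) (htpy_E _) (htpy_E _) (htpy_E _) (htpy_E _)
    (htpy_E _)
  have H2 := htpy_d_Ex (k := pre3) h2 h2' (htpy_E _) (htpy_E _) (htpy_E _) (htpy_E _) (htpy_E _)
    (htpy_E _)
  have H3 := htpy_d_Ex (k := pre4) h3 h3' (htpy_E _) (htpy_E _) (htpy_E _) (htpy_E _) (htpy_E _)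
    (htpy_E _)
  have H4 := htpy_d_Ex (k := pre5) h4 h4' (htpy_E _) (htpy_E _) (htpy_E _) (htpy_E _) (htpy_E _)
    (htpy_E _)
  have H5 := htpy_d_Ex (k := 0) h5 h5' (htpy_E _) (htpy_E _) (htpy_E _) (htpy_E _) (map_zero _)
    (map_zero _)
  cases g with
  | xp1 => exact H1.1
  | xm1 => exact H1.2
  | xp2 => exact H2.1
  | xm2 => exact H2.2
  | xp3 => exact H3.1
  | xm3 => exact H3.2
  | xp4 => exact H4.1
  | xm4 => exact H4.2
  | xp5 => exact H5.1
  | xm5 => exact H5.2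
  | _ => exact absurd (by decide) hg

theorem htpy_isContraction : IsContraction (coord x0) gen (htpy.restrictScalars R) := by
  intro w
  simp only [LinearMap.coe_restrictScalars]
  induction w using baseChange_induction with
  | h0 => simp
  | hadd v w hv hw =>
    simp only [map_add, add_smul]
    rw [add_add_add_comm, hv, hw, add_add_add_comm]
  | ht r g =>
    -- `htpy` is `R₀`-linear, so the two terms with `d r` from the Leibniz rule cancel and the basis
    -- elements suffice.
    suffices h : DGMod.d R₀ (htpy (E g)) + htpy (DGMod.d R₀ (E g)) =
        E g + extend (coord x0) (E g) • gen by
      simp only [map_smul, DGMod.d_smul, map_add]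
      rw [smul_eq_mul, mul_smul, ← smul_add, ← h, smul_add,
        add_add_add_comm, add_self_eq_zero' R₀, zero_add]
    have hy : ∀ {y w w' : R₀ ⊗[R] M} {y'}, htpy y = w → htpy y' = w' →
        DGMod.d R₀ w = y + Q • (w + w') → htpy (Q • (y + y')) = Q • (w + w') ∧
        DGMod.d R₀ w + htpy (Q • (y + y')) = y := by
      intro y w w' y' h1 h2 h3
      have e : htpy (Q • (y + y')) = Q • (w + w') := by rw [map_smul, map_add, h1, h2]
      exact ⟨e, by rw [e, h3, add_assoc, add_self_eq_zero' R₀, add_zero]⟩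
    by_cases hg : g = x0
    -- As `htpy` kills `x_0`, the contraction identity there is the definition of `gen`.
    · subst hg
      rw [extend_E, if_pos rfl, one_smul, gen, ← add_assoc, add_self_eq_zero' R₀, zero_add, htpy_E]
      simp [htpyGen]
    rw [extend_E, if_neg hg, zero_smul, add_zero]
    obtain ⟨⟨e1, e1'⟩, ⟨e2, e2'⟩, ⟨e3, e3'⟩, ⟨e4, e4'⟩, e5, e5'⟩ := d_Ey
    have hyp : ∀ {g g' : Gen} {k : (R₀ ⊗[R] M) × (R₀ ⊗[R] M)}, htpyGen g = k.1 →
        htpyGen g' = k.2 →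
        DGMod.d R₀ k.1 = E g + Q • (k.1 + k.2) ∧ DGMod.d R₀ k.2 = E g' + Q • (k.1 + k.2) →
        DGMod.d R₀ (E g) = Q • (E g + E g') ∧ DGMod.d R₀ (E g') = Q • (E g + E g') →
        (DGMod.d R₀ (htpy (E g)) + htpy (DGMod.d R₀ (E g)) = E g) ∧
        (DGMod.d R₀ (htpy (E g')) + htpy (DGMod.d R₀ (E g')) = E g') := by
      intro g g' k h1 h2 h3 h4
      rw [h4.1, h4.2, map_smul, map_add, htpy_E, htpy_E, h1, h2, h3.1, h3.2, add_assoc, add_assoc,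
        add_self_eq_zero' R₀, add_zero, add_zero]
      exact ⟨rfl, rfl⟩
    have H1 := hyp (k := pre1) rfl rfl d_pre1 ⟨e1, e1'⟩
    have H2 := hyp (k := pre2) rfl rfl d_pre2 ⟨e2, e2'⟩
    have H3 := hyp (k := pre3) rfl rfl d_pre3 ⟨e3, e3'⟩
    have H4 := hyp (k := pre4) rfl rfl d_pre4 ⟨e4, e4'⟩
    have H5 := hyp (k := pre5) rfl rfl d_pre5 ⟨e5, e5'⟩
    cases g with
    | x0 => exact absurd rfl hg
    | yp1 => exact H1.1
    | ym1 => exact H1.2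
    | yp2 => exact H2.1
    | ym2 => exact H2.2
    | yp3 => exact H3.1
    | ym3 => exact H3.2
    | yp4 => exact H4.1
    | ym4 => exact H4.2
    | yp5 => exact H5.1
    | ym5 => exact H5.2
    | _ => rw [htpy_d_E (by decide), htpy_E, htpyGen, map_zero, zero_add]

/-- The values of `htpy` are combinations of the `x_j` with `j ≠ 0` only. Hence `gen` still has
`x_0`-coordinate `1`. -/
theorem extend_htpy (w : R₀ ⊗[R] M) : extend (coord x0) (htpy w) = 0 := by
  have hstep : ∀ {a b : R₀} {x x' : R₀ ⊗[R] M} {k : (R₀ ⊗[R] M) × (R₀ ⊗[R] M)},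
      extend (coord x0) x = 0 → extend (coord x0) x' = 0 →
      extend (coord x0) k.1 = 0 ∧ extend (coord x0) k.2 = 0 →
      extend (coord x0) (step Uinv Q a b x x' k).1 = 0 ∧
        extend (coord x0) (step Uinv Q a b x x' k).2 = 0 := by
    intro a b x x' k h1 h2 h3
    simp [step, h1, h2, h3.1, h3.2]
  have hx : ∀ {g : Gen}, g ≠ x0 → extend (coord x0) (E g) = 0 := fun hg => by
    rw [extend_E, if_neg hg]
  have h5 : extend (coord x0) pre5.1 = 0 ∧ extend (coord x0) pre5.2 = 0 :=
    hstep (hx (by decide)) (hx (by decide)) (by simp)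
  have h4 : extend (coord x0) pre4.1 = 0 ∧ extend (coord x0) pre4.2 = 0 :=
    hstep (hx (by decide)) (hx (by decide)) h5
  have h3 : extend (coord x0) pre3.1 = 0 ∧ extend (coord x0) pre3.2 = 0 :=
    hstep (hx (by decide)) (hx (by decide)) h4
  have h2 : extend (coord x0) pre2.1 = 0 ∧ extend (coord x0) pre2.2 = 0 :=
    hstep (hx (by decide)) (hx (by decide)) h3
  have h1 : extend (coord x0) pre1.1 = 0 ∧ extend (coord x0) pre1.2 = 0 :=
    hstep (hx (by decide)) (hx (by decide)) h2
  induction w using baseChange_induction with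
  | h0 => simp
  | hadd v w hv hw => rw [map_add, map_add, hv, hw, add_zero]
  | ht r g =>
    rw [map_smul, map_smul, htpy_E]
    cases g <;> simp [htpyGen, h1, h2, h3, h4, h5]

theorem extend_gen : extend (coord x0) gen = 1 := by
  rw [gen, map_add, extend_htpy, extend_E, if_pos rfl, add_zero]

theorem E_mem' {g : Gen} {n : ℤ} (h : g.deg = n) : E g ∈ DGMod.deg R₀ n := h ▸ E_mem g

theorem U_pow_mem (n : ℕ) {m : ℤ} (h : n • 2 = m) : U ^ n ∈ DGAlg.deg (A := R₀) m :=
  h ▸ SetLike.pow_mem_graded n U_mem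

theorem Q_sq_mem : Q ^ 2 ∈ DGAlg.deg (A := R₀) 2 := SetLike.pow_mem_graded 2 Q_mem

/-- In this and the next lemmas the degree is one less than that of the matching `y_j`, as befits a
preimage under `d`. -/
theorem pre5_mem : pre5.1 ∈ DGMod.deg R₀ (-14) ∧ pre5.2 ∈ DGMod.deg R₀ (-14) :=
  step_mem (i := 0) (j := -12) (n := -12) (zero_mem _) (zero_mem _) (by norm_num) (by norm_num)
    (E_mem' rfl) (E_mem' rfl) (zero_mem _) (zero_mem _)

theorem pre4_mem : pre4.1 ∈ DGMod.deg R₀ (-8) ∧ pre4.2 ∈ DGMod.deg R₀ (-8) :=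
  step_mem (i := 8) (j := -14) (n := -6) (U_pow_mem 4 (by norm_num)) (zero_mem _) (by norm_num)
    (by norm_num) (E_mem' rfl) (E_mem' rfl) pre5_mem.1 pre5_mem.2

theorem pre3_mem : pre3.1 ∈ DGMod.deg R₀ (-4) ∧ pre3.2 ∈ DGMod.deg R₀ (-4) := by
  have hQU : Q ^ 2 * U ^ 2 ∈ DGAlg.deg (A := R₀) (2 + 4) :=
    SetLike.mul_mem_graded Q_sq_mem (U_pow_mem 2 (by norm_num))
  exact step_mem (i := 2 + 4) (j := -8) (n := -2) (U_pow_mem 3 (by norm_num)) hQU (by norm_num)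
    (by norm_num) (E_mem' rfl) (E_mem' rfl) pre4_mem.1 pre4_mem.2

theorem pre2_mem : pre2.1 ∈ DGMod.deg R₀ (-2) ∧ pre2.2 ∈ DGMod.deg R₀ (-2) :=
  step_mem (i := 4) (j := -4) (n := 0) (U_pow_mem 2 (by norm_num)) (zero_mem _) (by norm_num)
    (by norm_num) (E_mem' rfl) (E_mem' rfl) pre3_mem.1 pre3_mem.2

theorem pre1_mem : pre1.1 ∈ DGMod.deg R₀ (-2) ∧ pre1.2 ∈ DGMod.deg R₀ (-2) :=
  step_mem (i := 2) (j := -2) (n := 0) U_mem Q_sq_mem (by norm_num) (by norm_num)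
    (E_mem' rfl) (E_mem' rfl) pre2_mem.1 pre2_mem.2

theorem gen_mem : gen ∈ DGMod.deg R₀ 0 := by
  have e1 : U • pre1.1 ∈ DGMod.deg R₀ (2 + -2) := DGMod.smul_mem U_mem pre1_mem.1
  have e2 : (U + Q ^ 2) • pre1.2 ∈ DGMod.deg R₀ (2 + -2) :=
    DGMod.smul_mem (add_mem U_mem Q_sq_mem) pre1_mem.2
  have e : htpy (DGMod.d R₀ (E x0)) = U • pre1.1 + (U + Q ^ 2) • pre1.2 := by
    rw [d_Ex.1, map_add, map_smul, map_smul, htpy_E, htpy_E, htpyGen, htpyGen]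
  rw [add_neg_cancel] at e1 e2
  rw [gen, e]
  exact add_mem (E_mem' rfl) (add_mem e1 e2)

/-- The contraction identity at the cycle `d x_0`, whose augmentation `d 1` vanishes, reads `d (htpy
(d x_0)) = d x_0`. -/
theorem d_gen : DGMod.d R₀ gen = 0 := by
  have h := htpy_isContraction (DGMod.d R₀ (E x0))
  simp only [LinearMap.coe_restrictScalars] at h
  rw [DGMod.d_d, map_zero, add_zero, extend_d coord_x0_isDGMap.2, extend_E, if_pos rfl,
    Derivation.map_one_eq_zero, zero_smul, add_zero] at h
  rw [gen, map_add, h, add_self_eq_zero' R₀]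

theorem isSplitting : IsSplitting (coord x0) gen where
  isDGMap := coord_x0_isDGMap
  mem := gen_mem
  d_eq := d_gen
  extend_eq := extend_gen
  acyclic w hw hp := by
    have h := htpy_isContraction w
    rw [hw, map_zero, hp, zero_smul, add_zero, add_zero] at h
    exact ⟨_, h.symm⟩

/-- A splitting of `N` gives a splitting of `N ⊗ M`. -/
theorem isSplitting_tensor {N : Type} [AddCommGroup N] [Module R N] [DGMod R N] {α : N →ₗ[R] R}
    {x : R₀ ⊗[R] N} (h : IsSplitting α x) :
    IsSplitting (mulFunctional α (coord x0)) (insert N gen x) :=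
  h.tensor coord_x0_isDGMap gen_mem d_gen extend_gen htpy_isContraction

end Contraction

end M

/-! ### Differentials of functionals and the Leibniz rule for their products. -/

section Functionals

variable {N P : Type} [AddCommGroup N] [Module R N] [AddCommGroup P] [Module R P]

theorem mulFunctional_add_left (α α' : N →ₗ[R] R) (β : P →ₗ[R] R) :
    mulFunctional (α + α') β = mulFunctional α β + mulFunctional α' β := by
  rw [mulFunctional, TensorProduct.map_add_left, LinearMap.comp_add]; rfl

theorem mulFunctional_add_right (α : N →ₗ[R] R) (β β' : P →ₗ[R] R) :
    mulFunctional α (β + β') = mulFunctional α β + mulFunctional α β' := by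
  rw [mulFunctional, TensorProduct.map_add_right, LinearMap.comp_add]; rfl

theorem mulFunctional_smul_left (r : R) (α : N →ₗ[R] R) (β : P →ₗ[R] R) :
    mulFunctional (r • α) β = r • mulFunctional α β := by
  rw [mulFunctional, TensorProduct.map_smul_left, LinearMap.comp_smul]; rfl

theorem mulFunctional_smul_right (r : R) (α : N →ₗ[R] R) (β : P →ₗ[R] R) :
    mulFunctional α (r • β) = r • mulFunctional α β := by
  rw [mulFunctional, TensorProduct.map_smul_right, LinearMap.comp_smul]; rfl

theorem mulFunctional_zero_right (α : N →ₗ[R] R) :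
    mulFunctional α (0 : P →ₗ[R] R) = 0 := by
  rw [mulFunctional, TensorProduct.map_zero_right, LinearMap.comp_zero]

variable [DGMod R N] [DGMod R P]

/-- `α'` is the differential of the functional `α`. -/
def IsDifferential (α α' : N →ₗ[R] R) : Prop :=
  ∀ n, α (DGMod.d R n) = R.d (α n) + α' n

theorem IsDifferential.mul {α α' : N →ₗ[R] R} {β β' : P →ₗ[R] R} (hα : IsDifferential α α')
    (hβ : IsDifferential β β') :
    IsDifferential (mulFunctional α β) (mulFunctional α' β + mulFunctional α β') := by
  intro z
  induction z using TensorProduct.induction_on with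
  | zero => simp
  | add v w hv hw => simp only [map_add, hv, hw]; abel
  | tmul n p =>
    change mulFunctional α β (DGMod.d R n ⊗ₜ[R] p + n ⊗ₜ[R] DGMod.d R p) = _
    simp only [map_add, LinearMap.add_apply, mulFunctional_tmul, hα n, hβ p, Derivation.leibniz,
      smul_eq_mul]
    ring

end Functionals

/-! ### The obstruction for cycles of the triple and fourth tensor powers. -/

namespace M

open Gen R

theorem sum_gen (f : Gen → R) : ∑ g, f g = f x0 + f xp1 + f xp2 + f xp3 + f xp4 + f xp5 +
    f xm1 + f xm2 + f xm3 + f xm4 + f xm5 + f yp1 + f yp2 + f yp3 + f yp4 + f yp5 +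
    f ym1 + f ym2 + f ym3 + f ym4 + f ym5 := by
  have : (Finset.univ : Finset Gen) = {x0, xp1, xp2, xp3, xp4, xp5, xm1, xm2, xm3, xm4, xm5,
    yp1, yp2, yp3, yp4, yp5, ym1, ym2, ym3, ym4, ym5} := rfl
  rw [this]
  simp only [Finset.sum_insert, Finset.mem_insert, Finset.mem_singleton, reduceCtorEq, or_self,
    not_false_eq_true, Finset.sum_singleton]
  ring

theorem coord_x0_differential : IsDifferential (coord x0) 0 := by
  intro v
  rw [LinearMap.zero_apply, add_zero]
  exact coord_x0_isDGMap.2 v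

/-- Modulo `U` and `Q ^ 2` only `θ ^ 2` times the coordinate of `x_0` and `Q` times that of `y_1 +
y_{-1}` remain: this is the trade of `θ ^ 2` for `Q`. -/
theorem coord_ym1_differential : IsDifferential (coord ym1)
    ((U + θ ^ 2 + Q ^ 2) • coord x0 + Q ^ 2 • coord xp1 + U • coord xm1 +
      Q • (coord yp1 + coord ym1)) := by
  intro v
  rw [coord_d, sum_gen]
  simp [dGen, e_apply, coord]
  ring

/-- The terms with `Q` cancel in the sum, and so do `U + θ ^ 2` in the two coefficients of `d x_0`.
Modulo `U` the differential is divisible by `Q ^ 2`. -/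
theorem coord_y1_differential : IsDifferential (coord yp1 + coord ym1)
    (Q ^ 2 • coord x0 + (U + Q ^ 2) • coord xp1 + U • coord xm1) := by
  intro v
  rw [LinearMap.add_apply, coord_d, coord_d, sum_gen, sum_gen]
  simp [dGen, e_apply, coord]
  linear_combination (v x0 * (U + θ ^ 2) + (v yp1 + v ym1) * Q) * R.two_eq_zero

/-- The difference of `h₁` and `h₂` gives `t ^ 2 * A = -q * C`. Then `q * h₃` gives `t ^ 2 * q * C =
-q ^ 2 * D`, and `q ^ 2 * h₄` gives `t ^ 2 * q ^ 2 * D = 0`, all because `q ^ 3 = 0`. -/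
theorem pow_six_mul_eq_zero {S : Type} [CommRing S] {q t A B C D a₁ a₂ a₃ b₁ b₂ b₃ b₄ b₅ c : S}
    (hq : q ^ 3 = 0) (h₁ : 0 = (t ^ 2 + q ^ 2) * A + q ^ 2 * B + q * C)
    (h₂ : 0 = q ^ 2 * A + q ^ 2 * B)
    (h₃ : 0 = q ^ 2 * a₁ + q ^ 2 * a₂ + ((t ^ 2 + q ^ 2) * C + q ^ 2 * a₃ + q * D))
    (h₄ : 0 = q ^ 2 * b₁ + q ^ 2 * b₂ + ((t ^ 2 + q ^ 2) * D + q ^ 2 * b₃ + q * c) +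
      (q ^ 2 * b₄ + q ^ 2 * b₅)) : t ^ 6 * A = 0 := by
  linear_combination -t ^ 4 * h₁ + t ^ 4 * h₂ + t ^ 2 * q * h₃ - q ^ 2 * h₄ +
    (t ^ 2 * (a₁ + a₂ + a₃ + C) - (q * (b₁ + b₂ + b₃ + b₄ + b₅) + q * D + c)) * hq

/-- For a cycle of `M ⊗ M ⊗ M`, the product of `θ ^ 6` and the leading coefficient lies in the ideal
generated by `U` and `Q ^ 3`. -/
theorem theta_pow_mul_mem {z : M ⊗[R] M ⊗[R] M} (hz : DGMod.d R z = 0) :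
    θ ^ 6 * mulFunctional (mulFunctional (coord x0) (coord x0)) (coord x0) z ∈
      Ideal.span {U, Q ^ 3} := by
  have X := coord_x0_differential
  have G := coord_ym1_differential
  have Y := coord_y1_differential
  -- The sum is made opaque so that the additivity lemmas below do not split it.
  generalize coord yp1 + coord ym1 = y at G Y
  have E1 := ((G.mul X).mul X) z
  have E2 := ((Y.mul X).mul X) z
  have E3 := ((Y.mul X).mul G) z
  have E4 := ((Y.mul G).mul Y) z
  -- Written as a multiple of `Q ^ 3`, the differential of each value vanishes in the quotient.
  rw [hz, map_zero, R.d_eq] at E1 E2 E3 E4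
  rw [← Ideal.Quotient.eq_zero_iff_mem]
  replace E1 := congrArg (Ideal.Quotient.mk (Ideal.span {U, Q ^ 3})) E1
  replace E2 := congrArg (Ideal.Quotient.mk (Ideal.span {U, Q ^ 3})) E2
  replace E3 := congrArg (Ideal.Quotient.mk (Ideal.span {U, Q ^ 3})) E3
  replace E4 := congrArg (Ideal.Quotient.mk (Ideal.span {U, Q ^ 3})) E4
  have hU : Ideal.Quotient.mk (Ideal.span {U, Q ^ 3}) U = 0 :=
    Ideal.Quotient.eq_zero_iff_mem.2 (Ideal.subset_span (by simp))
  have hQ : Ideal.Quotient.mk (Ideal.span {U, Q ^ 3}) Q ^ 3 = 0 := by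
    rw [← map_pow]
    exact Ideal.Quotient.eq_zero_iff_mem.2 (Ideal.subset_span (by simp))
  simp only [mulFunctional_add_left, mulFunctional_add_right, mulFunctional_smul_left,
    mulFunctional_smul_right, mulFunctional_zero_right,
    LinearMap.add_apply, LinearMap.smul_apply, smul_eq_mul, map_add, map_mul,
    map_pow, map_zero, hU, hQ, mul_zero, zero_mul, zero_add,
    add_zero] at E1 E2 E3 E4 ⊢
  exact pow_six_mul_eq_zero hQ E1 E2 E3 E4

/-- The ideal is monomial and does not contain `θ ^ 6 * Q ^ 2`; the indices `1` and `2` stand for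
`Q` and `θ`. -/
theorem coeff_eq_zero_of_mem {p : R} (hp : θ ^ 6 * p ∈ Ideal.span {U, Q ^ 3}) :
    MvPolynomial.coeff (Finsupp.single 1 2) p = 0 := by
  obtain ⟨a, b, h⟩ := Ideal.mem_span_pair.1 hp
  have := congrArg (MvPolynomial.coeff (Finsupp.single 2 6 + Finsupp.single 1 2)) h
  rw [θ, MvPolynomial.X_pow_eq_monomial, MvPolynomial.coeff_monomial_mul, one_mul] at this
  rw [← this, U, Q, MvPolynomial.X_pow_eq_monomial, MvPolynomial.coeff_add,
    MvPolynomial.coeff_mul_X', MvPolynomial.coeff_mul_monomial', if_neg, if_neg, add_zero]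
  · intro hle
    have := hle 1
    simp at this
  · simp

/-- The leading coefficient of a cycle of `M ⊗ M ⊗ M` does not contain the monomial `Q ^ 2`. -/
theorem coeff_tensor_three (z : M ⊗[R] M ⊗[R] M) (hz : DGMod.d R z = 0) :
    MvPolynomial.coeff (Finsupp.single 1 2)
      (mulFunctional (mulFunctional (coord x0) (coord x0)) (coord x0) z) = 0 :=
  coeff_eq_zero_of_mem (theta_pow_mul_mem hz)

/-- The map `N ⊗ M → N` given by the coordinate of `x_0`. -/
def forget (N : Type) [AddCommGroup N] [Module R N] : N ⊗[R] M →ₗ[R] N :=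
  TensorProduct.rid R N ∘ₗ (coord x0).lTensor N

theorem forget_tmul {N : Type} [AddCommGroup N] [Module R N] (n : N) (m : M) :
    forget N (n ⊗ₜ[R] m) = coord x0 m • n := by simp [forget]

theorem forget_d {N : Type} [AddCommGroup N] [Module R N] [DGMod R N] (z : N ⊗[R] M) :
    forget N (DGMod.d R z) = DGMod.d R (forget N z) := by
  induction z using TensorProduct.induction_on with
  | zero => simp
  | add v w hv hw => simp only [map_add, hv, hw]
  | tmul n m =>
    change forget N (DGMod.d R n ⊗ₜ[R] m + n ⊗ₜ[R] DGMod.d R m) = _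
    rw [map_add, forget_tmul, forget_tmul, forget_tmul, DGMod.d_smul, coord_x0_isDGMap.2 m,
      add_comm]
    rfl

theorem mulFunctional_coord_x0 {N : Type} [AddCommGroup N] [Module R N] (α : N →ₗ[R] R)
    (z : N ⊗[R] M) : mulFunctional α (coord x0) z = α (forget N z) := by
  induction z using TensorProduct.induction_on with
  | zero => simp
  | add v w hv hw => simp only [map_add, hv, hw]
  | tmul n m => rw [mulFunctional_tmul, forget_tmul, map_smul, smul_eq_mul, mul_comm]

/-- If `α` maps no cycle of `N` to a polynomial with the monomial `m`, then its product with the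
coordinate of `x_0` maps no cycle of `N ⊗ M` to such a polynomial. -/
theorem coeff_tensor_M {N : Type} [AddCommGroup N] [Module R N] [DGMod R N] {α : N →ₗ[R] R}
    {m : Fin 3 →₀ ℕ} (h : ∀ z : N, DGMod.d R z = 0 → MvPolynomial.coeff m (α z) = 0)
    (z : N ⊗[R] M) (hz : DGMod.d R z = 0) :
    MvPolynomial.coeff m (mulFunctional α (coord x0) z) = 0 := by
  rw [mulFunctional_coord_x0]
  exact h _ (by rw [← forget_d, hz, map_zero])

end M

/-! ### Evaluation and the coefficient of `Q ^ 2` on `R₀`. -/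

namespace R₀

/-- The evaluation at `Q = 0`, `U = 1`. -/
def eval : R₀ →ₐ[ZMod 2] ZMod 2 :=
  AddMonoidAlgebra.lift (ZMod 2) (ZMod 2) (ℕ × ℤ)
    { toFun := fun p => 0 ^ p.toAdd.1
      map_one' := by simp
      map_mul' := fun p q => by simp [pow_add] }

theorem eval_mono (i : ℕ) (j : ℤ) : eval (mono i j) = 0 ^ i := by
  simp [eval, mono]

theorem eval_d (a : R₀) : eval (d a) = 0 := by
  induction a using induction with
  | h0 => simp
  | hadd a b ha hb => rw [map_add, map_add, ha, hb, add_zero]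
  | hm i j => rw [d_mono, map_smul, eval_mono]; simp

/-- In degree zero, `1` is the only monomial without `Q`. The evaluation, unlike the coefficient, is
multiplicative on all of `R₀`. -/
theorem eval_of_mem {a : R₀} (ha : a ∈ DGAlg.deg (A := R₀) 0) : eval a = a.coeff (0, 0) := by
  rw [eval, AddMonoidAlgebra.lift_apply, Finsupp.sum]
  rw [Finset.sum_eq_single (0, 0)]
  · simp
  · rintro ⟨i, j⟩ hm hne
    have hw : (i : ℤ) + 2 * j = 0 := ha (i, j) hm
    have hi : i ≠ 0 := by
      rintro rfl
      have : j = 0 := by simpa using hw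
      exact hne (by rw [this])
    simp [hi]
  · intro h
    rw [Finsupp.notMem_support_iff.1 h, zero_smul]

theorem coeff_mono (i k : ℕ) (j l : ℤ) :
    (mono i j).coeff (k, l) = if i = k ∧ j = l then 1 else 0 := by
  rw [mono, AddMonoidAlgebra.coeff_single, Finsupp.single_apply]
  simp only [Prod.mk.injEq]

theorem coeff_d (a : R₀) : (d a).coeff (2, 0) = 0 := by
  induction a using induction with
  | h0 => simp
  | hadd a b ha hb => rw [map_add, AddMonoidAlgebra.coeff_add, Finsupp.add_apply, ha, hb, add_zero]
  | hm i j =>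
    rw [d_mono, AddMonoidAlgebra.coeff_smul, Finsupp.smul_apply, coeff_mono, if_neg (by omega),
      smul_zero]

theorem coeff_Q_sq_mul (a : R₀) : (Q ^ 2 * a).coeff (2, 0) = a.coeff (0, 0) := by
  induction a using induction with
  | h0 => simp
  | hadd a b ha hb =>
    rw [mul_add, AddMonoidAlgebra.coeff_add, Finsupp.add_apply, ha, hb]; rfl
  | hm i j =>
    rw [pow_two, Q, mono_mul, mono_mul, coeff_mono, coeff_mono]
    congr 1
    simp

theorem Q_pow (n : ℕ) : Q ^ n = mono n 0 := by simp [Q, mono, AddMonoidAlgebra.single_pow]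
theorem U_pow (n : ℕ) : U ^ n = mono 0 n := by simp [U, mono, AddMonoidAlgebra.single_pow]

theorem coeff_algebraMap (p : R) :
    (algebraMap R R₀ p).coeff (2, 0) = MvPolynomial.coeff (Finsupp.single 1 2) p := by
  induction p using MvPolynomial.induction_on' with
  | add p q hp hq =>
    rw [map_add, AddMonoidAlgebra.coeff_add, Finsupp.add_apply, hp, hq, MvPolynomial.coeff_add]
  | monomial m a =>
    have h : m = Finsupp.single 1 2 ↔ m 0 = 0 ∧ m 1 = 2 ∧ m 2 = 0 := by
      simp [Finsupp.ext_iff, Fin.forall_fin_succ, Finsupp.single_apply]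
    rw [algebraMap_R, MvPolynomial.aeval_monomial, MvPolynomial.coeff_monomial,
      Finsupp.prod_fintype _ _ (by simp), Fin.prod_univ_three, ← Algebra.smul_def,
      AddMonoidAlgebra.coeff_smul, Finsupp.smul_apply]
    simp only [Matrix.cons_val_zero, Matrix.cons_val_one, Matrix.cons_val, U_pow, Q_pow, mono_mul]
    by_cases h2 : m 2 = 0
    · simp only [h, h2, pow_zero, mul_one, coeff_mono, zero_add, add_zero]
      by_cases h0 : m 0 = 0 <;> by_cases h1 : m 1 = 2 <;> simp [h0, h1]
    · simp [h, h2]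

end R₀

/-! ### Criteria for local maps of level two out of `R`. -/

section Level

variable {P : Type} [AddCommGroup P] [Module R P] [DGMod R P]

theorem extend_id_tmul_one (w : R₀ ⊗[R] R) :
    w = extend (LinearMap.id : R →ₗ[R] R) w • ((1 : R₀) ⊗ₜ[R] (1 : R)) := by
  induction w using TensorProduct.induction_on with
  | zero => simp
  | add v w hv hw => rw [map_add, add_smul, ← hv, ← hw]
  | tmul r a =>
    rw [extend_tmul, TensorProduct.smul_tmul', smul_eq_mul, mul_one, mul_comm, LinearMap.id_apply,
      ← Algebra.smul_def, TensorProduct.smul_tmul, smul_eq_mul, mul_one]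

theorem d_one : DGMod.d R (1 : R) = 0 := by
  have h : DGAlg.d (1 : R) = 0 := Derivation.map_one_eq_zero _
  exact h

theorem d_one_tmul_one : DGMod.d R₀ ((1 : R₀) ⊗ₜ[R] (1 : R)) = 0 := by
  have h : DGMod.d R (1 : R) = 0 := d_one
  rw [baseChange_d_tmul, h, Derivation.map_one_eq_zero, TensorProduct.zero_tmul,
    TensorProduct.tmul_zero, add_zero]

theorem one_tmul_one_mem : (1 : R₀) ⊗ₜ[R] (1 : R) ∈ DGMod.deg R₀ (M := R₀ ⊗[R] R) 0 :=
  tmul_mem_deg (add_zero 0) (SetLike.one_mem_graded _) (SetLike.one_mem_graded (DGAlg.deg (A := R)))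

theorem id_isSplitting : IsSplitting (LinearMap.id : R →ₗ[R] R) ((1 : R₀) ⊗ₜ[R] (1 : R)) where
  isDGMap := ⟨fun n m hm => by rwa [add_zero], fun _ => rfl⟩
  mem := one_tmul_one_mem
  d_eq := d_one_tmul_one
  extend_eq := by simp
  acyclic w _ hp := ⟨0, by rw [extend_id_tmul_one w, hp, zero_smul, map_zero]⟩

/-- If `π` maps no cycle of `P` to a polynomial with the monomial `Q ^ 2`, then there is no local
map of level two from `R` to `P`. -/
theorem IsSplitting.not_existsLocalMap {π : P →ₗ[R] R} {y : R₀ ⊗[R] P} (h : IsSplitting π y)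
    (hc : ∀ z : P, DGMod.d R z = 0 → MvPolynomial.coeff (Finsupp.single 1 2) (π z) = 0) :
    ¬ ExistsLocalMap R P 2 := by
  rintro ⟨f, -, -, hf, f', hf', k, -, hk⟩
  have hz : DGMod.d R (f 1) = 0 := by
    rw [← hf.2 1]
    exact (congrArg f d_one).trans (map_zero f)
  set o : R₀ ⊗[R] R := (1 : R₀) ⊗ₜ[R] (1 : R) with ho
  have hmem : extend π (f' o) ∈ DGAlg.deg (A := R₀) 0 :=
    extend_mem h.isDGMap.1 (by simpa using hf'.1.1 0 o one_tmul_one_mem)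
  -- In the homotopy identity at the cycle `1 ⊗ 1`, the boundary and `π (f 1)` have no `Q ^ 2` term,
  -- so `π (f' (1 ⊗ 1))` has no constant term.
  have h1 := congrArg (fun w => (extend π w).coeff (2, 0)) (hk o)
  have h0 : (extend π (f' o)).coeff (0, 0) = 0 := by
    rw [ho, d_one_tmul_one, ← ho] at h1
    have e : extend π (f.baseChange R₀ o) = algebraMap R R₀ (π (f 1)) := by
      rw [ho, LinearMap.baseChange_tmul, extend_tmul, one_mul]
    simp only [map_zero, add_zero, map_sub, LinearMap.smul_apply, map_smul, smul_eq_mul, e] at h1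
    have e2 : (extend π (DGMod.d R₀ (k o))).coeff (2, 0) = 0 := by
      rw [extend_d h.isDGMap.2]
      exact R₀.coeff_d _
    rw [e2, AddMonoidAlgebra.coeff_sub, Finsupp.sub_apply, R₀.coeff_algebraMap, hc _ hz,
      R₀.coeff_Q_sq_mul, zero_sub, neg_eq_zero] at h1
    exact h1
  -- Surjectivity on cohomology writes `y` as `f' m` plus a boundary, with `m` a multiple of `1 ⊗
  -- 1`. Applying `π` and evaluating at `Q = 0`, `U = 1` gives `1 = 0`.
  obtain ⟨m, -, b, hb⟩ := hf'.2.2 y h.d_eq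
  have h2 := congrArg (fun w => R₀.eval (extend π w)) hb
  have e3 : R₀.eval (extend π (DGMod.d R₀ b)) = 0 := by
    rw [extend_d h.isDGMap.2]
    exact R₀.eval_d _
  rw [extend_id_tmul_one m] at h2
  simp only [map_add, map_smul, smul_eq_mul, map_mul, h.extend_eq, map_one, e3, ← ho,
    R₀.eval_of_mem hmem, h0, mul_zero, add_zero] at h2
  exact one_ne_zero h2

/-- A cycle of degree two which `π` maps to `Q ^ 2` gives a local map of level two. -/
theorem IsSplitting.existsLocalMap {π : P →ₗ[R] R} {y : R₀ ⊗[R] P} (h : IsSplitting π y) {z : P}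
    (hz : z ∈ DGMod.deg R 2) (hd : DGMod.d R z = 0) (hπ : π z = R.Q ^ 2) :
    ExistsLocalMap R P 2 := by
  have hid := id_isSplitting
  have hyz : DGMod.d R₀ ((1 : R₀) ⊗ₜ[R] z - R₀.Q ^ 2 • y) = 0 := by
    rw [map_sub, baseChange_d_tmul, hd, Derivation.map_one_eq_zero, TensorProduct.zero_tmul,
      TensorProduct.tmul_zero, DGMod.d_smul, h.d_eq, M.d_Q_sq, zero_smul, smul_zero]
    simp
  obtain ⟨b, hb⟩ := h.acyclic _ hyz (by
    rw [map_sub, extend_tmul, hπ, map_pow, R₀.algebraMap_Q, map_smul, h.extend_eq]; simp)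
  -- A primitive of degree one is needed for the homotopy to have degree `2 - 1`.
  obtain ⟨b, hbm, hb⟩ := exists_homogeneous_primitive (n := 1) (by
    refine sub_mem (tmul_mem_deg (zero_add _) (SetLike.one_mem_graded _) hz) ?_
    have := DGMod.smul_mem M.Q_sq_mem h.mem
    rwa [add_zero] at this) hb
  -- The three maps send the generator to `z`, to `y` (the quasi-isomorphism) and to `b` (the
  -- homotopy).
  refine ⟨LinearMap.toSpanSingleton R P z, hid.isWeakSWFType, h.isWeakSWFType, ⟨?_, ?_⟩,
    LinearMap.toSpanSingleton R₀ _ y ∘ₗ extend LinearMap.id, ⟨⟨?_, ?_⟩, ?_, ?_⟩,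
    LinearMap.toSpanSingleton R₀ _ b ∘ₗ extend LinearMap.id, ?_, ?_⟩
  · intro n a ha
    exact DGMod.smul_mem ha hz
  · intro a
    rw [LinearMap.toSpanSingleton_apply, LinearMap.toSpanSingleton_apply, DGMod.d_smul, hd,
      smul_zero, add_zero]
    rfl
  · intro n w hw
    exact h.isQuasiIso.1.1 n _ (extend_mem hid.isDGMap.1 hw)
  · intro w
    rw [LinearMap.comp_apply, extend_d hid.isDGMap.2]
    exact h.isQuasiIso.1.2 _
  · intro w hw hwb
    obtain ⟨c, hc⟩ := h.isQuasiIso.2.1 (extend LinearMap.id w)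
      (by rw [← map_zero (extend (LinearMap.id : R →ₗ[R] R)), ← hw, extend_d hid.isDGMap.2]; rfl)
      hwb
    refine ⟨c • ((1 : R₀) ⊗ₜ[R] (1 : R)), ?_⟩
    rw [DGMod.d_smul, d_one_tmul_one, smul_zero, add_zero, extend_id_tmul_one w, hc]
    rfl
  · intro w hw
    obtain ⟨r, hr, hb⟩ := h.isQuasiIso.2.2 w hw
    refine ⟨r • ((1 : R₀) ⊗ₜ[R] (1 : R)), ?_, ?_⟩
    · have hr' : DGAlg.d r = 0 := hr
      rw [DGMod.d_smul, d_one_tmul_one, smul_zero, add_zero, hr', zero_smul]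
    · rwa [LinearMap.comp_apply, map_smul, hid.extend_eq, smul_eq_mul, mul_one]
  · intro n w hw
    exact DGMod.smul_mem (extend_mem hid.isDGMap.1 hw) hbm
  · intro w
    have e : (LinearMap.toSpanSingleton R P z).baseChange R₀ w =
        extend LinearMap.id w • ((1 : R₀) ⊗ₜ[R] z) := by
      conv_lhs => rw [extend_id_tmul_one w]
      rw [map_smul, LinearMap.baseChange_tmul, LinearMap.toSpanSingleton_apply, one_smul]
    simp only [LinearMap.smul_apply, LinearMap.comp_apply, LinearMap.toSpanSingleton_apply, e,
      extend_d hid.isDGMap.2, DGMod.d_smul]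
    rw [add_right_comm, add_self_eq_zero' R₀, zero_add, ← hb, smul_sub, smul_comm]

end Level

/-! ### The cycle of degree one over `Q`. -/

namespace M

open Gen R

/-- A cycle of degree one, which gives a local map of level one from `R` to `M`. -/
def cycle : M := Q • e x0 + (U + θ ^ 2 + Q ^ 2) • e yp1

theorem d_cycle : DGMod.d R cycle = 0 := by
  have h : ∀ g, DGMod.d R (e g) = dGen g := d_e
  have hQ : DGAlg.d Q = 0 := d_Q
  -- This `Q ^ 3` makes up for the `Q ^ 2` by which the coefficients of `y_1` and `y_{-1}` in `d
  -- x_0` differ.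
  have hw : DGAlg.d (U + θ ^ 2 + Q ^ 2) = Q ^ 3 := by
    change R.d (U + θ ^ 2 + Q ^ 2) = Q ^ 3
    simp [Derivation.leibniz_pow]
  rw [cycle, map_add, DGMod.d_smul, DGMod.d_smul, h, h, hQ, hw]
  simp only [dGen]
  have h2 := R.two_eq_zero
  match_scalars <;> grind

theorem cycle_mem : cycle ∈ DGMod.deg R 1 := by
  have hw : (U + θ ^ 2 + Q ^ 2).IsWeightedHomogeneous weight 2 :=
    (U_weight.add (by simpa using θ_weight.pow 2)).add (by simpa using Q_weight.pow 2)
  exact add_mem (smul_e_mem Q_weight rfl) (smul_e_mem hw rfl)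

theorem coord_cycle : coord x0 cycle = Q := by
  simp [cycle, coord, e_apply]

end M

end DG

end

theorem mainTheorem8 :
    (DG.IsWeakSWFType DG.M ∧
      DG.IsWeakSWFType (DG.M ⊗[DG.R] DG.M) ∧
      DG.IsWeakSWFType (DG.M ⊗[DG.R] DG.M ⊗[DG.R] DG.M) ∧
      DG.IsWeakSWFType (DG.M ⊗[DG.R] DG.M ⊗[DG.R] DG.M ⊗[DG.R] DG.M)) ∧
    ¬ DG.ExistsLocalMap DG.R (DG.M ⊗[DG.R] DG.M ⊗[DG.R] DG.M) 2 ∧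
    ¬ DG.ExistsLocalMap DG.R (DG.M ⊗[DG.R] DG.M ⊗[DG.R] DG.M ⊗[DG.R] DG.M) 2 ∧
    DG.ExistsLocalMap DG.R (DG.M ⊗[DG.R] DG.M) 2 := by
  have h2 := DG.M.isSplitting_tensor DG.M.isSplitting
  have h3 := DG.M.isSplitting_tensor h2
  have h4 := DG.M.isSplitting_tensor h3
  have hc := @DG.M.coeff_tensor_three
  -- Tensor products associate to the left, so the fourth power is the third tensored with `M`, and
  -- `coeff_tensor_M` passes the obstruction on.
  refine ⟨⟨DG.M.isSplitting.isWeakSWFType, h2.isWeakSWFType, h3.isWeakSWFType,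
    h4.isWeakSWFType⟩, h3.not_existsLocalMap hc,
    h4.not_existsLocalMap (DG.M.coeff_tensor_M hc),
    h2.existsLocalMap (z := DG.M.cycle ⊗ₜ[DG.R] DG.M.cycle)
      (DG.tmul_mem_tensorDeg (by norm_num) DG.M.cycle_mem DG.M.cycle_mem) ?_ ?_⟩
  · exact (DG.tensorD_tmul _ _).trans (by
      rw [DG.M.d_cycle, TensorProduct.zero_tmul, TensorProduct.tmul_zero, add_zero])
  · rw [DG.mulFunctional_tmul, DG.M.coord_cycle, pow_two]
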